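/- Let $K$ be a field, $n\ge 2$, $r=n-2$, $R=K[x_0,\dots,x_r,t,u]$ the coordinate ring of $\mathbb P^n_K$, and let $L\subset\mathbb P^n$ be the line with ideal $I_L=(x_0,\dots,x_r)$ and coordinate ring $S=K[t,u]$. Let $0\le k\le n-1$ and let $C\subset\mathbb P^n$ be an $(n-k)$-rope supported on $L$, i.e. a locally Cohen–Macaulay one-dimensional closed subscheme of degree $n-k$ with support $L$ whose (saturated) homogeneous ideal satisfies $I_L^2\subseteq I_C$. (a) There are integers $\alpha_0,\dots,\alpha_{r-k}\ge 0$, $\beta_1,\dots,\beta_k\ge 0$ and matrices $A=(a_{ij})$ of size $(r+1-k)\times(r+1)$ and $B=(b_{jl})$ of size $(r+1)\times k$ with homogeneous entries in $S$, $a_{ij}$ of degree $\alpha_i$ and $b_{jl}$ of degree $\beta_l$, such that $I_C=\big(I_L^2,\,[x_0,\dots,x_r]B\big)$ and the sequence $$0\to\bigoplus_{j=1}^k\mathcal O_L(-\beta_j-1)\xrightarrow{\,B\,}\mathcal O_L(-1)^{r+1}\xrightarrow{\,A\,}\bigoplus_{i=0}^{r-k}\mathcal O_L(\alpha_i-1)\to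 0$$ is exact. (b) Let $\alpha,\beta,A,B$ be any data as in (a). For $J=\{j_0<\dots<j_{r-k}\}\subseteq\{0,\dots,r\}$ let $A_J$ be the submatrix of $A$ formed by the columns with index in $J$, let $U_J=\{p\in\mathbb P^n\mid \det A_J(p)\ne 0\}$, and define sections over $U_J$ by $(z_0^J,\dots,z_{r-k}^J)=(x_{j_0},\dots,x_{j_{r-k}})A_J^{-1}$. Then there are unique global sections $z_i\in H^0(C,\mathcal O_C(1-\alpha_i))$, $0\le i\le r-k$, that restrict to $z_i^J$ on $U_J$ for all $J$. For all $d\in\mathbb Z$, $$H^0(C,\mathcal O_C(d))=\Big\{P+\sum_{i=0}^{r-k}Q_iz_i\ \Big|\ P,Q_i\in S \text{ homogeneous},\ \deg P=d,\ \deg Q_i=d+\alpha_i-1\Big\}$$ (where the zero polynomial has every degree, and is the only one of negative degree), and $H^0_*(C,\mathcal O_C)=\bigoplus_{d\in\mathbb Z}H^0(C,\mathcal O_C(d))$ is a free $S$-module with basis $1,z_0,\dots,z_{r-k}$. -/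

import Mathlib

noncomputable section

namespace Rope

open MvPolynomial

attribute [local instance] MvPolynomial.gradedAlgebra

/-- The coordinate ring `R = K[x₀, …, xᵣ, t, u]` of `ℙⁿ_K`, where `r = n - 2`. The index `Sum.inl j`
stands for `x_j`, the indices `Sum.inr 0` and `Sum.inr 1` stand for `t` and `u`. -/
abbrev R (K : Type*) [Field K] (n : ℕ) := MvPolynomial (Fin (n - 1) ⊕ Fin 2) K

/-- The coordinate ring `S = K[t, u]` of the line `L`. -/
abbrev S (K : Type*) [Field K] := MvPolynomial (Fin 2) K

variable {K : Type*} [Field K] {n : ℕ}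

/-- The inclusion `S ⊆ R`. -/
def incl (K : Type*) [Field K] (n : ℕ) : S K →ₐ[K] R K n := rename Sum.inr

/-- The variable `x_j`. -/
def x (K : Type*) [Field K] {n : ℕ} (j : Fin (n - 1)) : R K n := X (Sum.inl j)

/-- The ideal `I_L = (x₀, …, xᵣ)` of the line `L`. -/
def lineIdeal (K : Type*) [Field K] (n : ℕ) : Ideal (R K n) := Ideal.span (Set.range (x K))

/-- `ℙⁿ_K = Proj R` as a topological space. -/
abbrev Pn (K : Type*) [Field K] (n : ℕ) :=
  ProjectiveSpectrum (homogeneousSubmodule (Fin (n - 1) ⊕ Fin 2) K)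

/-- The (prime) ideal of `R` that is the point `p` of `ℙⁿ`. -/
abbrev pt (p : Pn K n) : Ideal (R K n) := p.asHomogeneousIdeal.toIdeal

/-! ### Closed subschemes of projective space and ropes

A closed subscheme `C` of `ℙⁿ` is given by its homogeneous ideal `I = I_C`, a homogeneous saturated
ideal of `R`. -/

/-- `I` is the homogeneous ideal of a closed subscheme of `ℙⁿ`: it is homogeneous, and saturated with
respect to the irrelevant ideal. -/
structure IsSubschemeIdeal (I : Ideal (R K n)) : Prop where
  homogeneous : I.IsHomogeneous (homogeneousSubmodule (Fin (n - 1) ⊕ Fin 2) K)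
  saturated : ∀ f : R K n, (∀ v, X v * f ∈ I) → f ∈ I

/-- The local ring `𝒪_{C,p}` of the closed subscheme `C` at `p ∈ C`: the quotient of
`𝒪_{ℙⁿ,p} = R_{(p)}` (homogeneous fractions of degree zero) by the fractions that lie in `I R_p`. -/
abbrev LocalRing (I : Ideal (R K n)) (p : Pn K n) :=
  HomogeneousLocalization.AtPrime (homogeneousSubmodule (Fin (n - 1) ⊕ Fin 2) K) (pt p) ⧸
    (I.map (algebraMap (R K n) (Localization.AtPrime (pt p)))).comap
      (algebraMap (HomogeneousLocalization.AtPrime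
        (homogeneousSubmodule (Fin (n - 1) ⊕ Fin 2) K) (pt p)) (Localization.AtPrime (pt p)))

/-- A Noetherian local ring is Cohen-Macaulay if it has a regular sequence of length equal to its Krull
dimension. (For a local ring the members of a regular sequence are in the maximal ideal.) -/
def IsCohenMacaulayLocal (O : Type*) [CommRing O] : Prop :=
  ∃ rs : List O, RingTheory.Sequence.IsRegular O rs ∧ (rs.length : WithBot ℕ∞) = ringKrullDim O

/-- `C` has dimension one and degree `e`: its Hilbert polynomial is `e d + c`, where the
Hilbert function is `d ↦ dim_K (R / I)_d`. -/
def HasDegree (I : Ideal (R K n)) (e : ℕ) : Prop :=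
  ∃ c : ℤ, ∀ᶠ d : ℕ in Filter.atTop,
    (Module.finrank K ((homogeneousSubmodule (Fin (n - 1) ⊕ Fin 2) K d).map
      (Ideal.Quotient.mkₐ K I).toLinearMap) : ℤ) = e * d + c

/-- `I` is the homogeneous ideal of an `e`-rope `C ⊆ ℙⁿ` supported on the line `L`: `C` is a locally
Cohen-Macaulay curve of degree `e` with support `L`, and `I_L² ⊆ I_C`. -/
structure IsRope (I : Ideal (R K n)) (e : ℕ) : Prop extends IsSubschemeIdeal I where
  locallyCM : ∀ p : Pn K n, I ≤ pt p → IsCohenMacaulayLocal (LocalRing I p)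
  support : ∀ p : Pn K n, I ≤ pt p ↔ lineIdeal K n ≤ pt p
  sq_le : lineIdeal K n ^ 2 ≤ I
  degree : HasDegree I e

/-! ### The matrices of a rope -/

/-- Matrices `A`, `B` with homogeneous entries from `S` such that
`0 → ⨁ⱼ 𝒪_L(-βⱼ-1) --B→ 𝒪_L(-1)^{r+1} --A→ ⨁ᵢ 𝒪_L(αᵢ-1) → 0`
is an exact sequence of sheaves on `L = Proj S` and `I_C = (I_L², [x₀, …, xᵣ] B)`.
Exactness is stated on stalks: at each point `p` of `Proj S`, the matrices give an exact
sequence over `S_p`. -/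
structure IsAssociated {k : ℕ} (I : Ideal (R K n)) (α : Fin (n - 1 - k) → ℕ) (β : Fin k → ℕ)
    (A : Matrix (Fin (n - 1 - k)) (Fin (n - 1)) (S K)) (B : Matrix (Fin (n - 1)) (Fin k) (S K)) :
    Prop where
  homA : ∀ i j, (A i j).IsHomogeneous (α i)
  homB : ∀ j l, (B j l).IsHomogeneous (β l)
  ideal_eq : I = lineIdeal K n ^ 2 ⊔ Ideal.span (Set.range fun l => ∑ j, x K j * incl K n (B j l))
  injective : ∀ p : ProjectiveSpectrum (homogeneousSubmodule (Fin 2) K),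
    Function.Injective
      (B.map (algebraMap (S K) (Localization.AtPrime p.asHomogeneousIdeal.toIdeal))).mulVec
  exact : ∀ p : ProjectiveSpectrum (homogeneousSubmodule (Fin 2) K),
    Function.Exact
      (B.map (algebraMap (S K) (Localization.AtPrime p.asHomogeneousIdeal.toIdeal))).mulVec
      (A.map (algebraMap (S K) (Localization.AtPrime p.asHomogeneousIdeal.toIdeal))).mulVec
  surjective : ∀ p : ProjectiveSpectrum (homogeneousSubmodule (Fin 2) K),
    Function.Surjective
      (A.map (algebraMap (S K) (Localization.AtPrime p.asHomogeneousIdeal.toIdeal))).mulVec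

/-! ### Global sections of the sheaves `𝒪_C(d)` -/

/-- The localization `(R / I)_p = R_p / I R_p`. The stalk of `𝒪_C(d)` at `p` is the set of its
fractions of degree `d`; it is zero if `p ∉ C`. -/
def Germ (I : Ideal (R K n)) (p : Pn K n) : Type _ :=
  Localization.AtPrime (pt p) ⧸ I.map (algebraMap (R K n) (Localization.AtPrime (pt p)))

instance (I : Ideal (R K n)) (p : Pn K n) : CommRing (Germ I p) :=
  inferInstanceAs (CommRing (Localization.AtPrime (pt p) ⧸
    I.map (algebraMap (R K n) (Localization.AtPrime (pt p)))))

/-- The canonical map `R_p → (R / I)_p`. -/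
def toGerm (I : Ideal (R K n)) (p : Pn K n) : Localization.AtPrime (pt p) →+* Germ I p :=
  Ideal.Quotient.mk _

instance (I : Ideal (R K n)) (p : Pn K n) : Algebra (R K n) (Germ I p) :=
  ((toGerm I p).comp (algebraMap (R K n) (Localization.AtPrime (pt p)))).toAlgebra

instance (I : Ideal (R K n)) (p : Pn K n) : Algebra (S K) (Germ I p) :=
  ((algebraMap (R K n) (Germ I p)).comp (incl K n).toRingHom).toAlgebra

instance (I : Ideal (R K n)) (p : Pn K n) : Algebra K (Germ I p) :=
  ((algebraMap (R K n) (Germ I p)).comp (algebraMap K (R K n))).toAlgebra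

/-- The fraction `a / b` in `(R / I)_p`. -/
def frac (I : Ideal (R K n)) (p : Pn K n) (a b : R K n) (hb : b ∉ pt p) : Germ I p :=
  toGerm I p (Localization.mk a ⟨b, hb⟩)

theorem frac_mul (I : Ideal (R K n)) (p : Pn K n) (a b : R K n) (hb : b ∉ pt p) :
    frac I p a b hb * algebraMap (R K n) (Germ I p) b = algebraMap (R K n) (Germ I p) a := by
  change toGerm I p _ * toGerm I p _ = toGerm I p _
  rw [← map_mul, ← Localization.mk_one_eq_algebraMap, ← Localization.mk_one_eq_algebraMap,
    Localization.mk_mul]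
  congr 1
  rw [Localization.mk_eq_mk_iff, Localization.r_iff_exists]
  exact ⟨1, by simp [mul_comm]⟩

theorem isUnit_algebraMap (I : Ideal (R K n)) (p : Pn K n) (b : R K n) (hb : b ∉ pt p) :
    IsUnit (algebraMap (R K n) (Germ I p) b) :=
  (IsLocalization.map_units (Localization.AtPrime (pt p))
    (⟨b, hb⟩ : (pt p).primeCompl)).map (toGerm I p)

theorem eq_frac_iff (I : Ideal (R K n)) (p : Pn K n) (a b : R K n) (hb : b ∉ pt p)
    (s : Germ I p) : s = frac I p a b hb ↔
      s * algebraMap (R K n) (Germ I p) b = algebraMap (R K n) (Germ I p) a := by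
  rw [← frac_mul I p a b hb]
  exact (isUnit_algebraMap I p b hb).mul_left_inj.symm

/-- `s` is a global section of `𝒪_C(d)`: it is a family of germs that is locally a
fraction `a / b` of homogeneous polynomials with `deg a - deg b = d`. -/
def IsSection (I : Ideal (R K n)) (d : ℤ) (s : ∀ p : Pn K n, Germ I p) : Prop :=
  ∀ p : Pn K n, ∃ V : Set (Pn K n), IsOpen V ∧ p ∈ V ∧
    ∃ (i j : ℕ) (a b : R K n), a.IsHomogeneous i ∧ b.IsHomogeneous j ∧ (i : ℤ) - j = d ∧
      ∀ q ∈ V, ∃ hb : b ∉ pt q, s q = frac I q a b hb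

/-- Homogeneous polynomials of `S` act on sections, shifting the degree. -/
theorem IsSection.smul {I : Ideal (R K n)} {d : ℤ} {s : ∀ p : Pn K n, Germ I p}
    (hs : IsSection I d s) {m : ℕ} {f : S K} (hf : f.IsHomogeneous m) :
    IsSection I (m + d) (f • s) := by
  intro p
  obtain ⟨V, hV, hp, i, j, a, b, ha, hb, hd, h⟩ := hs p
  refine ⟨V, hV, hp, m + i, j, incl K n f * a, b,
    (IsHomogeneous.rename_isHomogeneous hf).mul ha, hb, by push_cast; omega, fun q hq => ?_⟩
  obtain ⟨hbq, hsq⟩ := h q hq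
  refine ⟨hbq, ?_⟩
  rw [eq_frac_iff] at hsq ⊢
  rw [Pi.smul_apply, Algebra.smul_def, mul_assoc, hsq, map_mul]
  rfl

/-- `H⁰(C, 𝒪_C(d))`. -/
def H0 (I : Ideal (R K n)) (d : ℤ) : Submodule K (∀ p : Pn K n, Germ I p) where
  carrier := {s | IsSection I d s}
  zero_mem' := fun p => by
    obtain ⟨v, hv⟩ : ∃ v : Fin (n - 1) ⊕ Fin 2, (X v : R K n) ∉ pt p := by
      by_contra! h
      refine p.not_irrelevant_le fun f hf => ?_
      have hf0 : coeff 0 f = 0 := by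
        have h1 := (HomogeneousIdeal.mem_irrelevant_iff _ f).1 hf
        have h2 : homogeneousComponent 0 f = 0 := by
          rw [← decomposition.decompose'_apply]; exact h1
        rw [homogeneousComponent_zero] at h2
        simpa using h2
      have hspan : f ∈ Ideal.span (Set.range (X : Fin (n - 1) ⊕ Fin 2 → R K n)) := by
        rw [← Set.image_univ, mem_ideal_span_X_image]
        intro m hm
        by_contra! hz
        have : m = 0 := by ext i; simpa using hz i (Set.mem_univ i)
        subst this
        exact (mem_support_iff.1 hm) hf0
      exact (Ideal.span_le.2 (by rintro _ ⟨v, rfl⟩; exact h v)) hspan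
    refine ⟨{q | (X v : R K n) ∉ pt q}, ?_, hv, d.toNat, (-d).toNat, 0,
      X v ^ (-d).toNat, isHomogeneous_zero _ _ _, ?_, by omega, fun q hq => ?_⟩
    · exact ProjectiveSpectrum.isOpen_basicOpen
        (homogeneousSubmodule (Fin (n - 1) ⊕ Fin 2) K) (a := X v)
    · simpa using (isHomogeneous_X K v).pow (-d).toNat
    · refine ⟨fun h => hq (q.isPrime.mem_of_pow_mem _ h), ?_⟩
      rw [eq_frac_iff]
      simp
  add_mem' := by
    intro s s' hs hs' p
    obtain ⟨V, hV, hp, i, j, a, b, ha, hb, hd, h⟩ := hs p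
    obtain ⟨V', hV', hp', i', j', a', b', ha', hb', hd', h'⟩ := hs' p
    have e : j + i' = i + j' := by omega
    refine ⟨V ∩ V', hV.inter hV', ⟨hp, hp'⟩, i + j', j + j', a * b' + b * a', b * b',
      (ha.mul hb').add (e ▸ hb.mul ha'), hb.mul hb', by push_cast; omega, fun q hq => ?_⟩
    obtain ⟨h1, e1⟩ := h q hq.1
    obtain ⟨h2, e2⟩ := h' q hq.2
    refine ⟨fun hm => (q.isPrime.mem_or_mem hm).elim h1 h2, ?_⟩
    rw [eq_frac_iff] at e1 e2 ⊢
    simp only [Pi.add_apply, map_mul, map_add]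
    linear_combination (algebraMap (R K n) (Germ I q) b') * e1 +
      (algebraMap (R K n) (Germ I q) b) * e2
  smul_mem' := by
    intro c s hs p
    obtain ⟨V, hV, hp, i, j, a, b, ha, hb, hd, h⟩ := hs p
    refine ⟨V, hV, hp, i, j, C c * a, b, by simpa using (isHomogeneous_C _ c).mul ha, hb, hd,
      fun q hq => ?_⟩
    obtain ⟨hbq, hsq⟩ := h q hq
    refine ⟨hbq, ?_⟩
    rw [eq_frac_iff] at hsq ⊢
    rw [Pi.smul_apply, Algebra.smul_def, mul_assoc, hsq, map_mul]
    rfl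

/-- The global section `1` of `𝒪_C`. -/
def one (I : Ideal (R K n)) : H0 I 0 :=
  ⟨1, fun p => ⟨Set.univ, isOpen_univ, trivial, 0, 0, 1, 1, isHomogeneous_one _ _,
    isHomogeneous_one _ _, by simp, fun q _ =>
      ⟨fun h => q.isPrime.ne_top ((Ideal.eq_top_iff_one _).2 h), by
        rw [eq_frac_iff]; simp⟩⟩⟩

/-- `ℕ` acts on the degrees `d ∈ ℤ` by addition. -/
instance natAddActionInt : AddAction ℕ ℤ where
  vadd m d := (m : ℤ) + d
  zero_vadd d := by change ((0 : ℕ) : ℤ) + d = d; simp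
  add_vadd m m' d := by
    change ((m + m' : ℕ) : ℤ) + d = (m : ℤ) + ((m' : ℤ) + d)
    push_cast; ring

instance (I : Ideal (R K n)) :
    SetLike.GradedSMul (homogeneousSubmodule (Fin 2) K) (H0 I) where
  smul_mem := fun {_ _ _ _} hf hs => IsSection.smul hs hf

/-- `H⁰_*(C, 𝒪_C) = ⨁_{d ∈ ℤ} H⁰(C, 𝒪_C(d))`. -/
abbrev H0star (I : Ideal (R K n)) := DirectSum ℤ fun d => H0 I d

/-- The structure of a graded `S`-module on `H⁰_*(C, 𝒪_C)`, given by the multiplication of sections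
by homogeneous polynomials. -/
instance H0star.module (I : Ideal (R K n)) : Module (S K) (H0star I) :=
  GradedModule.isModule (homogeneousSubmodule (Fin 2) K) (H0 I)

/-- The homogeneous polynomials in `S` of degree `e ∈ ℤ` (zero only, if `e < 0`). -/
def SDeg (K : Type*) [Field K] (e : ℤ) : Set (S K) :=
  {f | f = 0 ∨ ∃ m : ℕ, (m : ℤ) = e ∧ f.IsHomogeneous m}

/-! ### The sections attached to the matrix `A` -/

/-- The open subset `U_J = {p ∈ ℙⁿ | det A_J (p) ≠ 0}`, where `J` is an increasing sequence
`j₀ < ⋯ < j_{r-k}` of column indices and `A_J` is the submatrix of `A` with these columns. -/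
def U {a : ℕ} (A : Matrix (Fin a) (Fin (n - 1)) (S K))
    (J : Fin a ↪o Fin (n - 1)) : Set (Pn K n) :=
  {p | incl K n (A.submatrix id J).det ∉ pt p}

/-- The germ at `p ∈ U_J` of `(z₀ᴶ, …, z_{r-k}ᴶ) = (x_{j₀}, …, x_{j_{r-k}}) A_J⁻¹`. -/
def zLocal {a : ℕ} (I : Ideal (R K n)) (A : Matrix (Fin a) (Fin (n - 1)) (S K))
    (J : Fin a ↪o Fin (n - 1)) (p : Pn K n) : Fin a → Germ I p :=
  Matrix.vecMul (fun c => algebraMap (R K n) (Germ I p) (x K (J c)))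
    ((A.submatrix id J).map (algebraMap (S K) (Germ I p)))⁻¹

/-- The global sections `z_i ∈ H⁰(C, 𝒪_C(1 - α_i))` restrict to `z_iᴶ` on each `U_J`. -/
def IsGlued {a : ℕ} (I : Ideal (R K n)) (α : Fin a → ℕ)
    (A : Matrix (Fin a) (Fin (n - 1)) (S K))
    (z : ∀ i : Fin a, H0 I (1 - (α i : ℤ))) : Prop :=
  ∀ (J : Fin a ↪o Fin (n - 1)), ∀ p ∈ U A J, ∀ i, (z i).1 p = zLocal I A J p i

end Rope

end

noncomputable section
namespace Rope
open MvPolynomial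
attribute [local instance] MvPolynomial.gradedAlgebra
variable {K : Type*} [Field K] {n : ℕ}

/-! Modulo `I_L²` a polynomial `f` equals its restriction to `L` plus a linear form `[x₀, …, xᵣ] v`
with `v` over `S` (`sub_restr_sub_lin_mem`). An ideal between `I_L²` and `I_L` is therefore the same
thing as a submodule `N` of `S^{r+1}` (`linearPart`, `mem_iff_linearPart`), and (a) becomes a
question about graded `S`-modules.

The Cohen-Macaulay condition and the saturation of `I` together say that `S^{r+1} / N` has no
homogeneous torsion. The homogeneous prime of a point of `L` is principal, say `(g)`, and a regular
nonunit of the local ring restricts to a multiple of `g`; this removes the powers of `g` from a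
multiplier (`IsRope.exists_smul_mem`). The multipliers of `v` into `N` then form a homogeneous ideal
without zeros on `L`. It contains powers of `t` and `u`, which saturation removes
(`IsRope.mem_of_smul_mem`).

A graded submodule of `S^m` that is saturated with respect to one variable has a homogeneous basis
(`exists_homogeneous_basis`): reduction modulo that variable turns it into a filtration of `K^m`,
and an adapted basis lifts. Bases of `N` and of its annihilator `N^⊥` give the columns of `B` and
the rows of `A`. The kernel of `A` is the double annihilator of `N`, hence `N`. Since `N^⊥` is
saturated, its basis stays independent modulo every prime `(g)`, so some maximal minor of `A` is
nonzero at each point (`exists_minor_notMem_of_perp`). The Hilbert function of `R / I` shows that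
the rank of `N` is `k` (`degree_eq`).

For (b), every admissible `A` has kernel `N` (`IsAssociated.mulVec_eq_zero_iff`). By Cramer's rule
`x = z A` is solvable over `U_J`, with a unique solution, so the local solutions glue. Let `F = Frac
S`. The first order expansion in the coordinates `z` is a ring homomorphism from `R` to `F ⊕ F^a`
with `a = r + 1 - k` and kernel exactly `I`. It extends to germs at the generic point of `L`, and a
section is determined by its expansion there (`section_eq_zero`). The coefficients of the expansion
are regular at every point of `L`, hence are polynomials of the right degrees
(`exists_coefficients`). Since `1, z₀, …, z_{r-k}` expand to the standard basis, both the
description of `H⁰(C, 𝒪_C(d))` and freeness follow. -/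

/-! ### Homogeneous components -/

/-- The degree `d` part of a vector of polynomials. -/
def vcomp {m : ℕ} (d : ℕ) (v : Fin m → S K) : Fin m → S K :=
  fun c => homogeneousComponent d (v c)

theorem vcomp_isHomogeneous {m : ℕ} (d : ℕ) (v : Fin m → S K) (c : Fin m) :
    (vcomp d v c).IsHomogeneous d :=
  homogeneousComponent_isHomogeneous _ _

theorem sum_homogeneousComponent_of_lt {σ : Type*} (f : MvPolynomial σ K) {D : ℕ}
    (hD : f.totalDegree < D) : ∑ d ∈ Finset.range D, homogeneousComponent d f = f := by
  conv_rhs => rw [← sum_homogeneousComponent (φ := f)]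
  symm
  apply Finset.sum_subset
  · intro i hi
    simp only [Finset.mem_range] at hi ⊢
    omega
  · intro i _ hi
    apply homogeneousComponent_eq_zero
    simp only [Finset.mem_range] at hi
    omega

theorem exists_sum_vcomp {m : ℕ} (v : Fin m → S K) :
    ∃ D, ∑ d ∈ Finset.range D, vcomp d v = v := by
  refine ⟨(Finset.univ.sup fun c => (v c).totalDegree) + 1, ?_⟩
  ext1 c
  rw [Finset.sum_apply]
  exact sum_homogeneousComponent_of_lt _
    (Nat.lt_succ_of_le (Finset.le_sup (f := fun c => (v c).totalDegree) (Finset.mem_univ c)))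

/-- An additive map that shifts degrees by `e` shifts homogeneous components by `e`. -/
theorem homogeneousComponent_map_of_shift {σ τ : Type*} (φ : MvPolynomial σ K →+ MvPolynomial τ K)
    (e : ℕ) (h : ∀ d f, f.IsHomogeneous d → (φ f).IsHomogeneous (d + e))
    (d : ℕ) (f : MvPolynomial σ K) :
    homogeneousComponent (d + e) (φ f) = φ (homogeneousComponent d f) := by
  conv_lhs => rw [← sum_homogeneousComponent (φ := f)]
  rw [map_sum, map_sum]
  have h1 : ∀ i, homogeneousComponent (d + e) (φ (homogeneousComponent i f)) =
      if d = i then φ (homogeneousComponent i f) else 0 := fun i => by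
    rw [homogeneousComponent_of_mem (h i _ (homogeneousComponent_isHomogeneous _ _))]
    simp
  simp only [h1, Finset.sum_ite_eq, Finset.mem_range]
  split_ifs with hd
  · rfl
  · rw [homogeneousComponent_eq_zero _ _ (by omega), map_zero]

theorem homogeneousComponent_mul_of_isHomogeneous {σ : Type*} {g : MvPolynomial σ K} {e : ℕ}
    (hg : g.IsHomogeneous e) (d : ℕ) (f : MvPolynomial σ K) :
    homogeneousComponent (d + e) (f * g) = homogeneousComponent d f * g :=
  homogeneousComponent_map_of_shift (AddMonoidHom.mulRight g) e (fun _ _ hf => hf.mul hg) d f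

theorem homogeneousComponent_mul_of_lt {σ : Type*} {g : MvPolynomial σ K} {e d : ℕ}
    (hg : g.IsHomogeneous e) (hd : d < e) (f : MvPolynomial σ K) :
    homogeneousComponent d (f * g) = 0 := by
  conv_lhs => rw [← sum_homogeneousComponent (φ := f)]
  rw [Finset.sum_mul, map_sum]
  apply Finset.sum_eq_zero
  intro i _
  rw [homogeneousComponent_of_mem ((homogeneousComponent_isHomogeneous i f).mul hg),
    if_neg (by omega)]

theorem isHomogeneous_of_mul {σ : Type*} {f g : MvPolynomial σ K} {e d : ℕ}
    (hg : g.IsHomogeneous e) (hg0 : g ≠ 0) (h : (f * g).IsHomogeneous (d + e)) :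
    f.IsHomogeneous d := by
  have h1 := homogeneousComponent_mul_of_isHomogeneous hg d f
  rw [homogeneousComponent_eq_self h] at h1
  rw [mul_right_cancel₀ hg0 h1]
  exact homogeneousComponent_isHomogeneous _ _

theorem eq_zero_of_mul_isHomogeneous {σ : Type*} {f g : MvPolynomial σ K} {e d : ℕ}
    (hg : g.IsHomogeneous e) (hg0 : g ≠ 0) (hd : d < e) (h : (f * g).IsHomogeneous d) :
    f = 0 := by
  have h1 := homogeneousComponent_mul_of_lt hg hd f
  rw [homogeneousComponent_eq_self h] at h1
  exact (mul_eq_zero.1 h1).resolve_right hg0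

/-- A submodule of `S ^ m` is graded if it contains the homogeneous parts of its elements. -/
def IsGraded {m : ℕ} (N : Submodule (S K) (Fin m → S K)) : Prop :=
  ∀ v ∈ N, ∀ d, vcomp d v ∈ N

/-! ### Graded submodules of `S ^ m` that are saturated with respect to a variable are free -/

/-- An independent set adapted to `W 0 ⊆ ⋯ ⊆ W E` extends inside `W (E + 1)`, and the filtration
stabilizes. Taking for `d l` the first index with `w l ∈ W (d l)` makes `d l ≤ e` equivalent to `w l
∈ W e`. -/
theorem exists_adapted_family {V : Type*} [AddCommGroup V] [Module K V] [FiniteDimensional K V]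
    (W : ℕ → Submodule K V) (hW : Monotone W) :
    ∃ (k : ℕ) (d : Fin k → ℕ) (w : Fin k → V), LinearIndependent K w ∧ (∀ l, w l ∈ W (d l)) ∧
      ∀ e, ∀ x ∈ W e, x ∈ Submodule.span K (w '' {l | d l ≤ e}) := by
  classical
  have step : ∀ E, ∃ s : Set V, LinearIndepOn K id s ∧ s ⊆ W E ∧
      ∀ e ≤ E, ∀ x ∈ W e, x ∈ Submodule.span K (s ∩ W e) := by
    intro E
    induction E with
    | zero =>
      obtain ⟨b, hb, -, hsp, hl⟩ := exists_linearIndepOn_id_extension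
        (linearIndepOn_empty K (id : V → V)) (Set.empty_subset (W 0 : Set V))
      refine ⟨b, hl, hb, fun e he x hx => ?_⟩
      obtain rfl : e = 0 := by omega
      rw [Set.inter_eq_left.2 hb]
      exact hsp hx
    | succ E ih =>
      obtain ⟨s, hs, hsW, hspan⟩ := ih
      obtain ⟨b, hb, hsb, hsp, hl⟩ := exists_linearIndepOn_id_extension hs
        (hsW.trans (hW (Nat.le_succ E)))
      refine ⟨b, hl, hb, fun e he x hx => ?_⟩
      rcases Nat.lt_or_ge E e with h | h
      · obtain rfl : e = E + 1 := by omega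
        rw [Set.inter_eq_left.2 hb]
        exact hsp hx
      · exact Submodule.span_mono (Set.inter_subset_inter_left _ hsb) (hspan e h x hx)
  obtain ⟨E, hE⟩ := monotone_stabilizes_iff_noetherian.2 (inferInstance : IsNoetherian K V)
    ⟨W, hW⟩
  obtain ⟨s, hs, hsW, hspan⟩ := step E
  have hfin : s.Finite := hs.linearIndependent.setFinite
  have := hfin.fintype
  have hmem : ∀ x : s, ∃ e, (x : V) ∈ W e := fun x => ⟨E, hsW x.2⟩
  let φ := Fintype.equivFin s
  refine ⟨Fintype.card s, fun l => Nat.find (hmem (φ.symm l)), fun l => φ.symm l,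
    hs.linearIndependent.comp _ φ.symm.injective, fun l => Nat.find_spec (hmem (φ.symm l)), ?_⟩
  intro e x hx
  have hx' : x ∈ Submodule.span K (s ∩ W e) := by
    rcases le_total e E with h | h
    · exact hspan e h x hx
    · have h1 : W E = W e := hE e h
      rw [← h1] at hx ⊢
      exact hspan E le_rfl x hx
  refine Submodule.span_mono ?_ hx'
  rintro y ⟨hy, hye⟩
  exact ⟨φ ⟨y, hy⟩, Nat.find_le (by simpa using hye), by simp⟩

/-- A homogeneous polynomial in two variables without a pure power of `X j` is divisible by the
other variable. -/
theorem X_dvd_of_coeff_eq_zero {i j : Fin 2} (hij : i ≠ j) {f : S K} {d : ℕ}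
    (hf : f.IsHomogeneous d) (h0 : coeff (Finsupp.single j d) f = 0) : X i ∣ f := by
  have : f ∈ Ideal.span (X '' {i} : Set (S K)) := by
    rw [mem_ideal_span_X_image]
    intro m hm
    refine ⟨i, rfl, fun hmi => ?_⟩
    have hdeg : m.degree = d := by
      by_contra hne
      exact (mem_support_iff.1 hm) (hf.coeff_eq_zero hne)
    have : m = Finsupp.single j d := by
      have h2 : ∀ a : Fin 2, a = i ∨ a = j := by omega
      have hs : m = Finsupp.single j (m j) := by
        ext a
        rcases h2 a with rfl | rfl
        · rw [hmi, Finsupp.single_eq_of_ne hij]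
        · simp
      rw [hs, Finsupp.degree_single] at hdeg
      rw [hs, hdeg]
    exact (mem_support_iff.1 hm) (this ▸ h0)
  rwa [Set.image_singleton, Ideal.mem_span_singleton] at this

/-- The specialization `X i ↦ 0`, `X j ↦ X` for `j ≠ i`. -/
def killVar (i : Fin 2) : S K →ₐ[K] Polynomial K :=
  aeval fun a => if a = i then 0 else Polynomial.X

theorem killVar_of_isHomogeneous {i j : Fin 2} (hij : i ≠ j) {f : S K} {d : ℕ}
    (hf : f.IsHomogeneous d) :
    killVar i f = Polynomial.C (coeff (Finsupp.single j d) f) * Polynomial.X ^ d := by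
  have h1 : (f - C (coeff (Finsupp.single j d) f) * X j ^ d).IsHomogeneous d :=
    hf.sub (isHomogeneous_C_mul_X_pow _ _ _)
  obtain ⟨g, hg⟩ := X_dvd_of_coeff_eq_zero hij h1 (by simp [coeff_C_mul, coeff_X_pow])
  rw [sub_eq_iff_eq_add] at hg
  conv_lhs => rw [hg]
  simp [killVar, hij.symm, Polynomial.C_eq_algebraMap]

theorem X_dvd_of_killVar_eq_zero {i : Fin 2} {f : S K} (h : killVar i f = 0) : X i ∣ f := by
  obtain ⟨j, hij⟩ : ∃ j : Fin 2, i ≠ j := ⟨1 - i, by omega⟩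
  rw [← sum_homogeneousComponent (φ := f)] at h ⊢
  apply Finset.dvd_sum
  intro d _
  apply X_dvd_of_coeff_eq_zero hij (homogeneousComponent_isHomogeneous d f)
  rw [map_sum, Finset.sum_congr rfl fun d _ =>
    killVar_of_isHomogeneous hij (homogeneousComponent_isHomogeneous d f)] at h
  have h1 := congrArg (fun q => Polynomial.coeff q d) h
  simp only [Polynomial.finsetSum_coeff, Polynomial.coeff_C_mul_X_pow, Finset.sum_ite_eq,
    Finset.mem_range, Polynomial.coeff_zero] at h1
  split_ifs at h1 with hd
  · exact h1
  · rw [homogeneousComponent_eq_zero _ _ (by omega), coeff_zero]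

theorem eq_zero_of_forall_X_pow_dvd {i : Fin 2} {f : S K} (h : ∀ N : ℕ, X i ^ N ∣ f) : f = 0 := by
  by_contra hf
  obtain ⟨N, hN⟩ := FiniteMultiplicity.of_not_isUnit (X_prime (R := K) (i := i)).not_isUnit hf
  exact hN (h _)

/-- Modulo `X i` the vector `b l` is its vector of `X j ^ d l`-coefficients times a power of the
remaining variable. Each coefficient of a relation modulo `X i` is thus a `K`-relation among these
vectors, so `X i` divides every `g l`. Dividing by `X i` and repeating makes `g l` divisible by all
powers of `X i`. -/
theorem linearIndependent_of_leading {i j : Fin 2} (hij : i ≠ j) {m k : ℕ} {d : Fin k → ℕ}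
    {b : Fin k → Fin m → S K} (hb : ∀ l c, (b l c).IsHomogeneous (d l))
    (hw : LinearIndependent K fun l c => coeff (Finsupp.single j (d l)) (b l c)) :
    LinearIndependent (S K) b := by
  rw [Fintype.linearIndependent_iff]
  intro g hg
  have key : ∀ g : Fin k → S K, ∑ l, g l • b l = 0 → ∀ l, X i ∣ g l := by
    intro g hg
    have h1 : ∀ c D, ∑ l, (killVar i (g l) * Polynomial.X ^ d l).coeff D *
        coeff (Finsupp.single j (d l)) (b l c) = 0 := by
      intro c D
      have h2 := congrArg (killVar i) (congrFun hg c)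
      simp only [Finset.sum_apply, Pi.smul_apply, smul_eq_mul, map_sum, map_mul,
        killVar_of_isHomogeneous hij (hb _ c), Pi.zero_apply, map_zero] at h2
      have h3 := congrArg (fun q => Polynomial.coeff q D) h2
      simp only [Polynomial.finsetSum_coeff, Polynomial.coeff_zero] at h3
      rw [← h3]
      refine Finset.sum_congr rfl fun l _ => ?_
      rw [mul_left_comm, Polynomial.coeff_C_mul, mul_comm]
    intro l
    apply X_dvd_of_killVar_eq_zero
    have h4 : killVar i (g l) * Polynomial.X ^ d l = 0 := by
      ext D
      rw [Polynomial.coeff_zero]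
      refine Fintype.linearIndependent_iff.1 hw
        (fun l => (killVar i (g l) * Polynomial.X ^ d l).coeff D) ?_ l
      ext c
      simpa using h1 c D
    exact (mul_eq_zero.1 h4).resolve_right (pow_ne_zero _ Polynomial.X_ne_zero)
  have key2 : ∀ N : ℕ, ∀ l, X i ^ N ∣ g l := by
    intro N
    induction N with
    | zero => simp
    | succ N ih =>
      choose g' hg' using ih
      have h5 : ∑ l, g' l • b l = 0 := by
        have : (X i ^ N : S K) • ∑ l, g' l • b l = 0 := by
          rw [Finset.smul_sum, ← hg]
          refine Finset.sum_congr rfl fun l _ => ?_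
          rw [smul_smul, ← hg']
        exact (smul_eq_zero.1 this).resolve_left (pow_ne_zero _ (X_ne_zero i))
      intro l
      rw [hg' l, pow_succ]
      exact mul_dvd_mul_left _ (key g' h5 l)
  exact fun l => eq_zero_of_forall_X_pow_dvd fun N => key2 N l

/-- An elementary form of the splitting of vector bundles on the projective line. The degree `d`
part of `N` modulo `X i` is a subspace `W d` of `K^m`, increasing in `d` because of multiplication
by `X j`. Lifts of a basis adapted to `W` are independent by `linearIndependent_of_leading` and
generate by induction on the degree. -/
theorem exists_homogeneous_basis {i : Fin 2} {m : ℕ} (N : Submodule (S K) (Fin m → S K))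
    (hN : IsGraded N) (hsat : ∀ v, (X i : S K) • v ∈ N → v ∈ N) :
    ∃ (k : ℕ) (d : Fin k → ℕ) (b : Fin k → Fin m → S K),
      (∀ l c, (b l c).IsHomogeneous (d l)) ∧ LinearIndependent (S K) b ∧
        Submodule.span (S K) (Set.range b) = N := by
  obtain ⟨j, hij⟩ : ∃ j : Fin 2, i ≠ j := ⟨1 - i, by omega⟩
  let W : ℕ → Submodule K (Fin m → K) := fun d =>
    { carrier := {w | ∃ v ∈ N, (∀ c, (v c).IsHomogeneous d) ∧
        ∀ c, w c = coeff (Finsupp.single j d) (v c)}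
      zero_mem' := ⟨0, N.zero_mem, fun _ => isHomogeneous_zero _ _ _, fun c => by simp⟩
      add_mem' := by
        rintro w w' ⟨v, hv, hd, hw⟩ ⟨v', hv', hd', hw'⟩
        exact ⟨v + v', N.add_mem hv hv', fun c => (hd c).add (hd' c), fun c => by
          simp [hw c, hw' c]⟩
      smul_mem' := by
        rintro a w ⟨v, hv, hd, hw⟩
        refine ⟨(C a : S K) • v, N.smul_mem _ hv, fun c => (hd c).C_mul a, fun c => ?_⟩
        simp [hw c, coeff_C_mul] }
  have hW : Monotone W := by
    apply monotone_nat_of_le_succ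
    rintro d w ⟨v, hv, hd, hw⟩
    refine ⟨(X j : S K) • v, N.smul_mem _ hv, fun c => ?_, fun c => ?_⟩
    · rw [add_comm]
      exact (isHomogeneous_X K j).mul (hd c)
    · rw [hw c, Pi.smul_apply, smul_eq_mul, add_comm d 1, Finsupp.single_add, coeff_X_mul]
  obtain ⟨k, d, w, hw, hwW, hspan⟩ := exists_adapted_family W hW
  choose b hbN hb hbw using hwW
  refine ⟨k, d, b, hb, linearIndependent_of_leading hij hb ?_, le_antisymm ?_ ?_⟩
  · rwa [show (fun l c => coeff (Finsupp.single j (d l)) (b l c)) = w from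
      funext fun l => funext fun c => (hbw l c).symm]
  · rw [Submodule.span_le]
    rintro _ ⟨l, rfl⟩
    exact hbN l
  · have key : ∀ e v, v ∈ N → (∀ c, (v c).IsHomogeneous e) →
        v ∈ Submodule.span (S K) (Set.range b) := by
      intro e
      induction e using Nat.strong_induction_on with
      | _ e ih =>
      intro v hv hve
      have h1 : (fun c => coeff (Finsupp.single j e) (v c)) ∈ W e := ⟨v, hv, hve, fun _ => rfl⟩
      have h2 := hspan e _ h1
      have h3 : ∀ y ∈ Submodule.span K (w '' {l | d l ≤ e}),
          ∃ v' ∈ N, v' ∈ Submodule.span (S K) (Set.range b) ∧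
          (∀ c, (v' c).IsHomogeneous e) ∧ ∀ c, y c = coeff (Finsupp.single j e) (v' c) := by
        intro y h2
        induction h2 using Submodule.span_induction with
        | mem y hy =>
          obtain ⟨l, hl, rfl⟩ := hy
          have hl : d l ≤ e := hl
          refine ⟨(X j ^ (e - d l) : S K) • b l, N.smul_mem _ (hbN l),
            Submodule.smul_mem _ _ (Submodule.subset_span ⟨l, rfl⟩), fun c => ?_, fun c => ?_⟩
          · have := (isHomogeneous_X_pow (R := K) j (e - d l)).mul (hb l c)
            rwa [Nat.sub_add_cancel hl] at this
          · rw [Pi.smul_apply, smul_eq_mul, hbw]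
            obtain ⟨p, rfl⟩ := Nat.exists_eq_add_of_le hl
            rw [Nat.add_sub_cancel_left, X_pow_eq_monomial, add_comm, Finsupp.single_add,
              coeff_monomial_mul, one_mul]
        | zero => exact ⟨0, N.zero_mem, Submodule.zero_mem _, fun _ => isHomogeneous_zero _ _ _,
            fun _ => by simp⟩
        | add y y' _ _ h h' =>
          obtain ⟨a, h1, h2, h3, h4⟩ := h
          obtain ⟨a', h1', h2', h3', h4'⟩ := h'
          exact ⟨a + a', N.add_mem h1 h1', Submodule.add_mem _ h2 h2',
            fun c => (h3 c).add (h3' c), fun c => by simp [h4, h4']⟩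
        | smul r y _ h =>
          obtain ⟨a, h1, h2, h3, h4⟩ := h
          exact ⟨(C r : S K) • a, N.smul_mem _ h1, Submodule.smul_mem _ _ h2,
            fun c => (h3 c).C_mul r, fun c => by simp [h4, coeff_C_mul]⟩
      obtain ⟨v', hv'N, hv's, hv'e, hv'c⟩ := h3 _ h2
      -- `v'` lies in the span and agrees with `v` modulo `X i`. By saturation the quotient of `v -
      -- v'` by `X i` is again in `N`, and its degree is smaller.
      have h4 : ∀ c, X i ∣ (v - v') c := fun c =>
        X_dvd_of_coeff_eq_zero hij ((hve c).sub (hv'e c)) (by simp [hv'c])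
      choose q hq using h4
      have h5 : v - v' = (X i : S K) • q := funext hq
      have hqN : q ∈ N := hsat q (h5 ▸ N.sub_mem hv hv'N)
      have h6 : v - v' ∈ Submodule.span (S K) (Set.range b) := by
        rw [h5]
        apply Submodule.smul_mem
        have hdeg : ∀ c, (q c * X i).IsHomogeneous e := fun c => by
          rw [mul_comm, ← hq]
          exact (hve c).sub (hv'e c)
        rcases Nat.eq_zero_or_pos e with h0 | h0
        · have : q = 0 := funext fun c => eq_zero_of_mul_isHomogeneous
            (isHomogeneous_X K i) (X_ne_zero i) (by omega) (hdeg c)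
          rw [this]
          exact Submodule.zero_mem _
        · refine ih (e - 1) (by omega) q hqN fun c => ?_
          exact isHomogeneous_of_mul (isHomogeneous_X K i) (X_ne_zero i)
            (by rw [Nat.sub_add_cancel h0]; exact hdeg c)
      have := Submodule.add_mem _ h6 hv's
      rwa [sub_add_cancel] at this
    intro v hv
    obtain ⟨D, hD⟩ := exists_sum_vcomp v
    rw [← hD]
    exact Submodule.sum_mem _ fun d _ => key d _ (hN v hv d) (vcomp_isHomogeneous d v)

/-- A homogeneous prime ideal of `S` that is not the irrelevant ideal is principal. -/
theorem exists_eq_span_singleton {i : Fin 2} (q : Ideal (S K)) [q.IsPrime]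
    (hq : q.IsHomogeneous (homogeneousSubmodule (Fin 2) K)) (hi : X i ∉ q) :
    ∃ (d : ℕ) (g : S K), g.IsHomogeneous d ∧ q = Ideal.span {g} := by
  -- A prime that omits `X i` is an `X i`-saturated submodule of `S^1`; its homogeneous basis has at
  -- most one element.
  let N : Submodule (S K) (Fin 1 → S K) := Submodule.comap (LinearMap.proj 0) q
  have hN : IsGraded N := fun v hv d =>
    (mem_iff_homogeneousComponent_mem hq (v 0)).1 hv d
  have hsat : ∀ v, (X i : S K) • v ∈ N → v ∈ N := fun v hv =>
    ((‹q.IsPrime›.mem_or_mem (show X i * v 0 ∈ q from hv))).resolve_left hi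
  obtain ⟨k, d, b, hb, hli, hsp⟩ := exists_homogeneous_basis N hN hsat
  have hk : k ≤ 1 := by
    have := hli.fintype_card_le_finrank
    simpa using this
  have hmem : ∀ f, f ∈ q ↔ (fun _ => f) ∈ Submodule.span (S K) (Set.range b) := fun f => by
    rw [hsp]; rfl
  obtain rfl | rfl : k = 0 ∨ k = 1 := by omega
  · refine ⟨0, 0, isHomogeneous_zero _ _ _, ?_⟩
    ext f
    rw [hmem, Set.range_eq_empty, Submodule.span_empty, Ideal.mem_span_singleton, zero_dvd_iff,
      Submodule.mem_bot, funext_iff]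
    simp
  · refine ⟨d 0, b 0 0, hb 0 0, ?_⟩
    ext f
    rw [hmem, Set.range_unique, Submodule.mem_span_singleton, Ideal.mem_span_singleton']
    simp only [funext_iff, Fin.forall_fin_one]
    rfl

/-! ### The first order expansion of a polynomial along the line -/

/-- Restriction to the line: `x_j ↦ 0`. -/
def restr (K : Type*) [Field K] (n : ℕ) : R K n →ₐ[K] S K := aeval (Sum.elim 0 X)

/-- The linear coefficient at `x_j` of the expansion along the line. -/
def lin (j : Fin (n - 1)) : R K n →ₗ[K] S K :=
  (restr K n).toLinearMap ∘ₗ (pderiv (Sum.inl j)).toLinearMap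

/-- The linear form `[x₀, …, xᵣ] v`. -/
def xdot (K : Type*) [Field K] (n : ℕ) : (Fin (n - 1) → S K) →+ R K n where
  toFun v := ∑ j, x K j * incl K n (v j)
  map_zero' := by simp
  map_add' v w := by simp [mul_add, Finset.sum_add_distrib]

theorem xdot_apply (v : Fin (n - 1) → S K) : xdot K n v = ∑ j, x K j * incl K n (v j) := rfl

theorem xdot_smul (f : S K) (v : Fin (n - 1) → S K) :
    xdot K n (f • v) = incl K n f * xdot K n v := by
  simp only [xdot_apply, Pi.smul_apply, smul_eq_mul, map_mul, Finset.mul_sum]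
  exact Finset.sum_congr rfl fun j _ => by ring

@[simp]
theorem restr_incl (f : S K) : restr K n (incl K n f) = f := by
  simp only [restr, incl, aeval_rename]
  exact (DFunLike.congr_fun (aeval_unique (AlgHom.id K (S K))) f).symm

@[simp]
theorem restr_x (j : Fin (n - 1)) : restr K n (x K j) = 0 := by
  simp [restr, x]

@[simp]
theorem restr_xdot (v : Fin (n - 1) → S K) : restr K n (xdot K n v) = 0 := by
  simp [xdot_apply]

theorem lin_mul (j : Fin (n - 1)) (f g : R K n) :
    lin j (f * g) = restr K n f * lin j g + restr K n g * lin j f := by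
  simp [lin]

@[simp]
theorem lin_x (i j : Fin (n - 1)) : lin i (x K j) = if i = j then 1 else 0 := by
  simp only [lin, x, LinearMap.comp_apply, Derivation.coeFn_coe, AlgHom.toLinearMap_apply]
  rw [pderiv_X]
  by_cases h : i = j
  · subst h; simp
  · simp [h, Ne.symm h]

@[simp]
theorem lin_incl (j : Fin (n - 1)) (f : S K) : lin j (incl K n f) = 0 := by
  simp only [lin, LinearMap.comp_apply, Derivation.coeFn_coe, incl, AlgHom.toLinearMap_apply]
  rw [pderiv_eq_zero_of_notMem_vars, map_zero]
  intro h
  have := vars_rename _ _ h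
  simp at this

@[simp]
theorem lin_xdot (j : Fin (n - 1)) (v : Fin (n - 1) → S K) : lin j (xdot K n v) = v j := by
  simp [xdot_apply, lin_mul]

theorem x_mem_lineIdeal (j : Fin (n - 1)) : x K j ∈ lineIdeal K n :=
  Ideal.subset_span ⟨j, rfl⟩

theorem xdot_mem_lineIdeal (v : Fin (n - 1) → S K) : xdot K n v ∈ lineIdeal K n := by
  rw [xdot_apply]
  exact Ideal.sum_mem _ fun j _ => Ideal.mul_mem_right _ _ (x_mem_lineIdeal j)

/-- Taylor's formula to first order along `L`. Multiplication by `x_j` moves the restriction into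
the `j`-th linear coefficient and everything else into `I_L²`; multiplication by `t` or `u` acts on
all terms alike. -/
theorem sub_restr_sub_lin_mem (f : R K n) :
    f - incl K n (restr K n f) - xdot K n (fun j => lin j f) ∈ lineIdeal K n ^ 2 := by
  induction f using MvPolynomial.induction_on with
  | C a =>
    have h : (C a : R K n) = incl K n (C a) := by simp [incl]
    rw [h]
    generalize (C a : S K) = f
    simp [xdot_apply]
  | add f g hf hg =>
    have h := Ideal.add_mem _ hf hg
    have e : (fun j => lin j (f + g)) = (fun j => lin j f) + fun j => lin j g := by
      ext1 j; simp
    rw [e, map_add, map_add, map_add]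
    convert h using 1
    ring
  | mul_X f v hf =>
    rcases v with j | i
    · have e : (fun i => lin i (f * x K j)) = restr K n f • Pi.single j 1 := by
        ext1 i
        simp [lin_mul, Pi.single_apply]
      have e2 : xdot K n (Pi.single j 1) = x K j := by
        simp [xdot_apply, Pi.single_apply, apply_ite]
      change f * x K j - incl K n (restr K n (f * x K j)) -
        xdot K n (fun i => lin i (f * x K j)) ∈ _
      rw [e, xdot_smul, e2, map_mul, restr_x, mul_zero, map_zero, sub_zero, ← sub_mul, pow_two]
      refine Ideal.mul_mem_mul ?_ (x_mem_lineIdeal j)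
      have h := Ideal.add_mem _ (Ideal.pow_le_self two_ne_zero hf)
        (xdot_mem_lineIdeal (fun j => lin j f))
      rwa [sub_add_cancel] at h
    · have h0 : (X (Sum.inr i) : R K n) = incl K n (X i) := by simp [incl]
      rw [h0]
      have e : (fun j => lin j (f * incl K n (X i))) = (X i : S K) • fun j => lin j f := by
        ext1 j
        simp [lin_mul]
      rw [e, xdot_smul, map_mul, restr_incl, map_mul]
      convert Ideal.mul_mem_left _ (incl K n (X i)) hf using 1
      ring

theorem mem_lineIdeal_iff {f : R K n} : f ∈ lineIdeal K n ↔ restr K n f = 0 := by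
  constructor
  · intro h
    have : lineIdeal K n ≤ RingHom.ker (restr K n) := by
      rw [lineIdeal, Ideal.span_le]
      rintro _ ⟨j, rfl⟩
      exact restr_x j
    exact this h
  · intro h
    have h1 := Ideal.add_mem _ (Ideal.pow_le_self two_ne_zero (sub_restr_sub_lin_mem f))
        (xdot_mem_lineIdeal (fun j => lin j f))
    rwa [sub_add_cancel, h, map_zero, sub_zero] at h1

theorem lin_eq_zero_of_mem_sq {f : R K n} (hf : f ∈ lineIdeal K n ^ 2) (j : Fin (n - 1)) :
    lin j f = 0 := by
  rw [pow_two] at hf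
  induction hf using Submodule.mul_induction_on' with
  | mem_mul_mem a ha b hb =>
    rw [lin_mul, mem_lineIdeal_iff.1 ha, mem_lineIdeal_iff.1 hb, zero_mul, zero_mul, add_zero]
  | add a _ b _ ha hb => rw [map_add, ha, hb, add_zero]

theorem sub_incl_restr_mem (f : R K n) : f - incl K n (restr K n f) ∈ lineIdeal K n := by
  rw [mem_lineIdeal_iff]
  simp

theorem incl_isHomogeneous {f : S K} {d : ℕ} (hf : f.IsHomogeneous d) :
    (incl K n f).IsHomogeneous d :=
  hf.rename_isHomogeneous

theorem restr_isHomogeneous {f : R K n} {d : ℕ} (hf : f.IsHomogeneous d) :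
    (restr K n f).IsHomogeneous d := by
  have := hf.aeval (Sum.elim 0 X : Fin (n - 1) ⊕ Fin 2 → S K) (n := 1) (by
    rintro (j | i)
    · exact isHomogeneous_zero _ _ _
    · exact isHomogeneous_X K i)
  rwa [one_mul] at this

theorem lin_isHomogeneous {f : R K n} {d : ℕ} (hf : f.IsHomogeneous d) (j : Fin (n - 1)) :
    (lin j f).IsHomogeneous (d - 1) :=
  restr_isHomogeneous hf.pderiv

theorem lin_isHomogeneous_zero {f : R K n} (hf : f.IsHomogeneous 0) (j : Fin (n - 1)) :
    lin j f = 0 := by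
  have h : f ∈ homogeneousSubmodule (Fin (n - 1) ⊕ Fin 2) K 0 := hf
  rw [homogeneousSubmodule_zero] at h
  obtain ⟨a, rfl⟩ := Submodule.mem_one.1 h
  rw [algebraMap_eq]
  have h : (C a : R K n) = incl K n (C a) := by simp [incl]
  rw [h, lin_incl]

theorem xdot_isHomogeneous {v : Fin (n - 1) → S K} {d : ℕ} (hv : ∀ j, (v j).IsHomogeneous d) :
    (xdot K n v).IsHomogeneous (d + 1) := by
  rw [xdot_apply]
  refine IsHomogeneous.sum _ _ _ fun j _ => ?_
  rw [add_comm]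
  exact (isHomogeneous_X K _).mul (incl_isHomogeneous (hv j))

theorem homogeneousComponent_restr (d : ℕ) (f : R K n) :
    homogeneousComponent d (restr K n f) = restr K n (homogeneousComponent d f) :=
  homogeneousComponent_map_of_shift (restr K n : R K n →+ S K) 0
    (fun _ _ hf => restr_isHomogeneous hf) d f

theorem homogeneousComponent_xdot (d : ℕ) (v : Fin (n - 1) → S K) :
    homogeneousComponent (d + 1) (xdot K n v) = xdot K n (vcomp d v) := by
  rw [xdot_apply, map_sum, xdot_apply]
  refine Finset.sum_congr rfl fun j _ => ?_
  have hx : (x K j : R K n).IsHomogeneous 1 := isHomogeneous_X K _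
  rw [mul_comm, homogeneousComponent_mul_of_isHomogeneous hx, mul_comm, vcomp, incl,
    rename_homogeneousComponent]

/-! ### Ideals between `I_L ^ 2` and `I_L` -/

/-- The submodule of `S ^ {r+1}` of the linear forms in `I`. -/
def linearPart (I : Ideal (R K n)) : Submodule (S K) (Fin (n - 1) → S K) where
  carrier := {v | xdot K n v ∈ I}
  zero_mem' := by simp
  add_mem' := fun {v w} hv hw => by
    simp only [Set.mem_ofPred_eq, map_add] at *
    exact I.add_mem hv hw
  smul_mem' := fun f v hv => by
    simp only [Set.mem_ofPred_eq, xdot_smul] at *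
    exact I.mul_mem_left _ hv

theorem mem_linearPart {I : Ideal (R K n)} {v : Fin (n - 1) → S K} :
    v ∈ linearPart I ↔ xdot K n v ∈ I := Iff.rfl

/-- The dictionary between ideals and submodules of `S^{r+1}`: subtracting an element of `I_L²`
leaves only the restriction and the linear form. -/
theorem mem_iff_linearPart {I : Ideal (R K n)} (h2 : lineIdeal K n ^ 2 ≤ I)
    (h1 : I ≤ lineIdeal K n) {f : R K n} :
    f ∈ I ↔ restr K n f = 0 ∧ (fun j => lin j f) ∈ linearPart I := by
  rw [mem_linearPart]
  have h := h2 (sub_restr_sub_lin_mem f)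
  constructor
  · intro hf
    have h0 := mem_lineIdeal_iff.1 (h1 hf)
    refine ⟨h0, ?_⟩
    rw [h0, map_zero, sub_zero] at h
    simpa using I.sub_mem hf h
  · rintro ⟨h0, hx⟩
    rw [h0, map_zero, sub_zero] at h
    simpa using I.add_mem h hx

theorem linearPart_isGraded {I : Ideal (R K n)}
    (hI : I.IsHomogeneous (homogeneousSubmodule (Fin (n - 1) ⊕ Fin 2) K)) :
    IsGraded (linearPart I) := fun v hv d => by
  rw [mem_linearPart, ← homogeneousComponent_xdot]
  exact (mem_iff_homogeneousComponent_mem hI _).1 hv _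

/-- Multiplying a linear form by `f` only depends on the restriction of `f` to the line. -/
theorem mul_xdot_mem_iff {I : Ideal (R K n)} (h2 : lineIdeal K n ^ 2 ≤ I) (f : R K n)
    (v : Fin (n - 1) → S K) : f * xdot K n v ∈ I ↔ restr K n f • v ∈ linearPart I := by
  have h : f * xdot K n v - xdot K n (restr K n f • v) ∈ I := by
    rw [xdot_smul, ← sub_mul]
    apply h2
    rw [pow_two]
    exact Ideal.mul_mem_mul (sub_incl_restr_mem f) (xdot_mem_lineIdeal v)
  rw [mem_linearPart]
  exact ⟨fun hf => by simpa using I.sub_mem hf h, fun hf => by simpa using I.add_mem h hf⟩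

/-! ### Points -/

theorem isHomogeneous_of_component {σ : Type*} {I : Ideal (MvPolynomial σ K)}
    (h : ∀ f ∈ I, ∀ d, homogeneousComponent d f ∈ I) :
    I.IsHomogeneous (homogeneousSubmodule σ K) := fun d f hf => by
  have := h f hf d
  rwa [← decomposition.decompose'_apply] at this

theorem X_mem_irrelevant {σ : Type*} (v : σ) :
    (X v : MvPolynomial σ K) ∈ HomogeneousIdeal.irrelevant (homogeneousSubmodule σ K) := by
  rw [HomogeneousIdeal.mem_irrelevant_iff]
  change ((decomposition.decompose' (X v) 0 : homogeneousSubmodule σ K 0) : MvPolynomial σ K) = 0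
  rw [decomposition.decompose'_apply, homogeneousComponent_of_mem (isHomogeneous_X K v),
    if_neg (by norm_num)]

theorem exists_X_notMem {σ : Type*} (p : ProjectiveSpectrum (homogeneousSubmodule σ K)) :
    ∃ v, (X v : MvPolynomial σ K) ∉ p.asHomogeneousIdeal.toIdeal := by
  by_contra! h
  refine p.not_irrelevant_le fun f hf => ?_
  have hf0 : coeff 0 f = 0 := by
    have h1 := (HomogeneousIdeal.mem_irrelevant_iff _ f).1 hf
    have h2 : homogeneousComponent 0 f = 0 := by
      rw [← decomposition.decompose'_apply]; exact h1
    rw [homogeneousComponent_zero] at h2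
    simpa using h2
  have hspan : f ∈ Ideal.span (Set.range (X : σ → MvPolynomial σ K)) := by
    rw [← Set.image_univ, mem_ideal_span_X_image]
    intro m hm
    by_contra! hz
    have : m = 0 := by ext i; simpa using hz i (Set.mem_univ i)
    subst this
    exact (mem_support_iff.1 hm) hf0
  exact (Ideal.span_le.2 (by rintro _ ⟨v, rfl⟩; exact h v)) hspan

/-- The point given by a homogeneous prime ideal that does not contain all variables. -/
def mkPoint {σ : Type*} (q : Ideal (MvPolynomial σ K)) (hq : q.IsPrime)
    (hom : ∀ f ∈ q, ∀ d, homogeneousComponent d f ∈ q) (hX : ∃ v, X v ∉ q) :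
    ProjectiveSpectrum (homogeneousSubmodule σ K) where
  asHomogeneousIdeal := ⟨q, isHomogeneous_of_component hom⟩
  isPrime := hq
  not_irrelevant_le := fun h => by
    obtain ⟨v, hv⟩ := hX
    exact hv (h (X_mem_irrelevant v))

/-- The ideal of a point of the line. -/
abbrev lpt (q : ProjectiveSpectrum (homogeneousSubmodule (Fin 2) K)) : Ideal (S K) :=
  q.asHomogeneousIdeal.toIdeal

theorem component_mem {σ : Type*} (p : ProjectiveSpectrum (homogeneousSubmodule σ K))
    {f : MvPolynomial σ K} (hf : f ∈ p.asHomogeneousIdeal.toIdeal) (d : ℕ) :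
    homogeneousComponent d f ∈ p.asHomogeneousIdeal.toIdeal :=
  (mem_iff_homogeneousComponent_mem p.asHomogeneousIdeal.isHomogeneous f).1 hf d

/-- The inclusion of the line in projective space. -/
def linePoint (n : ℕ) (q : ProjectiveSpectrum (homogeneousSubmodule (Fin 2) K)) : Pn K n :=
  mkPoint ((lpt q).comap (restr K n)) (q.isPrime.comap _)
    (fun f hf d => by
      rw [Ideal.mem_comap] at hf ⊢
      rw [← homogeneousComponent_restr]
      exact component_mem q hf d)
    (by
      obtain ⟨v, hv⟩ := exists_X_notMem q
      exact ⟨Sum.inr v, by simpa [restr] using hv⟩)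

theorem mem_linePoint {q : ProjectiveSpectrum (homogeneousSubmodule (Fin 2) K)} {f : R K n} :
    f ∈ pt (linePoint n q) ↔ restr K n f ∈ lpt q := Iff.rfl

theorem lineIdeal_le_linePoint (q : ProjectiveSpectrum (homogeneousSubmodule (Fin 2) K)) :
    lineIdeal K n ≤ pt (linePoint n q) := fun f hf => by
  rw [mem_linePoint, mem_lineIdeal_iff.1 hf]
  exact Ideal.zero_mem _

theorem exists_eq_linePoint {p : Pn K n} (hp : lineIdeal K n ≤ pt p) :
    ∃ q, p = linePoint n q := by
  have key : ∀ f, f ∈ pt p ↔ incl K n (restr K n f) ∈ pt p := fun f => by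
    have h := hp (sub_incl_restr_mem f)
    exact ⟨fun hf => by simpa using Ideal.sub_mem _ hf h,
      fun hf => by simpa using Ideal.add_mem _ h hf⟩
  refine ⟨mkPoint ((pt p).comap (incl K n)) (p.isPrime.comap _) (fun f hf d => ?_) ?_, ?_⟩
  · rw [Ideal.mem_comap] at hf ⊢
    rw [incl, rename_homogeneousComponent]
    exact component_mem p hf d
  · obtain ⟨v, hv⟩ := exists_X_notMem p
    rcases v with j | i
    · exact absurd (hp (x_mem_lineIdeal j)) hv
    · exact ⟨i, by simpa [incl] using hv⟩
  · apply ProjectiveSpectrum.ext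
    apply HomogeneousIdeal.toIdeal_injective
    ext f
    exact key f

/-- The generic point of the line, in the line. -/
def genericLine (K : Type*) [Field K] : ProjectiveSpectrum (homogeneousSubmodule (Fin 2) K) :=
  mkPoint ⊥ Ideal.isPrime_bot (fun f hf d => by
    rw [Ideal.mem_bot] at hf ⊢; rw [hf, map_zero]) ⟨0, by simp [X_ne_zero]⟩

/-- The support condition at the generic point of `L` suffices, as the ideal of that point is `I_L`.
-/
theorem IsRope.le_lineIdeal {I : Ideal (R K n)} {e : ℕ} (hI : IsRope I e) : I ≤ lineIdeal K n := by
  have h := (hI.support (linePoint n (genericLine K))).2 (lineIdeal_le_linePoint _)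
  refine h.trans fun f hf => ?_
  exact mem_lineIdeal_iff.2 hf

/-! ### The Cohen-Macaulay condition -/

/-- A homogeneous ideal of `S` that vanishes at no point of the line contains a power of each
variable. -/
theorem exists_X_pow_mem {J : Ideal (S K)} (hJ : ∀ f ∈ J, ∀ d, homogeneousComponent d f ∈ J)
    (h : ∀ q : ProjectiveSpectrum (homogeneousSubmodule (Fin 2) K), ∃ f ∈ J, f ∉ lpt q)
    (i : Fin 2) : ∃ N : ℕ, X i ^ N ∈ J := by
  change X i ∈ J.radical
  -- The radical is the intersection of the homogeneous primes containing `J`. Such a prime without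
  -- `X i` would be a point of the line at which `J` vanishes.
  rw [(isHomogeneous_of_component hJ).radical_eq, Submodule.mem_sInf]
  rintro Q ⟨hQ, hJQ, hprime⟩
  by_contra hX
  obtain ⟨f, hf, hfQ⟩ := h (mkPoint Q hprime
    (fun f hf => (mem_iff_homogeneousComponent_mem hQ f).1 hf) ⟨i, hX⟩)
  exact hfQ (hJQ hf)

/-- In dimension zero every nonunit is nilpotent. So `r₀` forces positive dimension, and the regular
sequence has a first member. -/
theorem IsCohenMacaulayLocal.exists_regular {O : Type*} [CommRing O] [IsLocalRing O]
    (hO : IsCohenMacaulayLocal O) {r₀ : O} (h0 : ¬ IsUnit r₀) (hn : ¬ IsNilpotent r₀) :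
    ∃ r : O, IsSMulRegular O r ∧ ¬ IsUnit r := by
  obtain ⟨rs, hrs, hdim⟩ := hO
  cases rs with
  | nil =>
    have hd : Ring.KrullDimLE 0 O := by
      rw [ringKrullDimZero_iff_ringKrullDim_eq_zero, ← hdim]
      simp
    refine absurd ?_ hn
    have h := Ring.KrullDimLE.radical_eq_maximalIdeal (⊥ : Ideal O) bot_ne_top
    rw [← mem_nilradical]
    change r₀ ∈ (⊥ : Ideal O).radical
    rw [h]
    exact (IsLocalRing.mem_maximalIdeal _).2 h0
  | cons r rs =>
    refine ⟨r, ((RingTheory.Sequence.isRegular_cons_iff O r rs).1 hrs).1, fun hu => ?_⟩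
    refine hrs.top_ne_smul ?_
    rw [Ideal.ofList_cons, Ideal.span_singleton_eq_top.2 hu, top_sup_eq, Ideal.smul_eq_mul,
      Ideal.top_mul]

/-- The class of a homogeneous fraction of degree zero in the local ring of `C` at `p`. -/
def locFrac (I : Ideal (R K n)) (p : Pn K n) {d : ℕ} {a b : R K n} (ha : a.IsHomogeneous d)
    (hb : b.IsHomogeneous d) (hbp : b ∉ pt p) : LocalRing I p :=
  Ideal.Quotient.mk _ (HomogeneousLocalization.mk ⟨d, ⟨a, ha⟩, ⟨b, hb⟩, hbp⟩)

theorem exists_eq_locFrac (I : Ideal (R K n)) (p : Pn K n) (r : LocalRing I p) :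
    ∃ (d : ℕ) (a b : R K n) (ha : a.IsHomogeneous d) (hb : b.IsHomogeneous d) (hbp : b ∉ pt p),
      r = locFrac I p ha hb hbp := by
  obtain ⟨r, rfl⟩ := Ideal.Quotient.mk_surjective r
  obtain ⟨⟨d, ⟨a, ha⟩, ⟨b, hb⟩, hbp⟩, rfl⟩ := HomogeneousLocalization.mk_surjective r
  exact ⟨d, a, b, ha, hb, hbp, rfl⟩

theorem mk_mem_map_iff (I : Ideal (R K n)) (p : Pn K n) (a b : R K n) (hb : b ∉ pt p) :
    Localization.mk a ⟨b, hb⟩ ∈ I.map (algebraMap (R K n) (Localization.AtPrime (pt p))) ↔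
      ∃ h ∉ pt p, h * a ∈ I := by
  rw [Localization.mk_eq_mk', IsLocalization.mk'_mem_map_algebraMap_iff]
  rfl

theorem locFrac_eq_zero_iff (I : Ideal (R K n)) (p : Pn K n) {d : ℕ} {a b : R K n}
    (ha : a.IsHomogeneous d) (hb : b.IsHomogeneous d) (hbp : b ∉ pt p) :
    locFrac I p ha hb hbp = 0 ↔ ∃ h ∉ pt p, h * a ∈ I := by
  rw [locFrac, Ideal.Quotient.eq_zero_iff_mem, Ideal.mem_comap,
    HomogeneousLocalization.algebraMap_apply, HomogeneousLocalization.val_mk]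
  exact mk_mem_map_iff I p a b hbp

theorem locFrac_mul (I : Ideal (R K n)) (p : Pn K n) {d d' : ℕ} {a b a' b' : R K n}
    (ha : a.IsHomogeneous d) (hb : b.IsHomogeneous d) (hbp : b ∉ pt p)
    (ha' : a'.IsHomogeneous d') (hb' : b'.IsHomogeneous d') (hbp' : b' ∉ pt p) :
    locFrac I p ha hb hbp * locFrac I p ha' hb' hbp' =
      locFrac I p (ha.mul ha') (hb.mul hb') (p.isPrime.mul_notMem hbp hbp') := rfl

theorem locFrac_pow (I : Ideal (R K n)) (p : Pn K n) {d : ℕ} {a b : R K n}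
    (ha : a.IsHomogeneous d) (hb : b.IsHomogeneous d) (hbp : b ∉ pt p) (N : ℕ) :
    locFrac I p ha hb hbp ^ N = locFrac I p (ha.pow N) (hb.pow N)
      (fun h => hbp (p.isPrime.mem_of_pow_mem _ h)) := by
  rw [locFrac, ← map_pow, locFrac]
  congr 1
  apply HomogeneousLocalization.val_injective
  rw [HomogeneousLocalization.val_pow, HomogeneousLocalization.val_mk,
    HomogeneousLocalization.val_mk, Localization.mk_pow]
  rfl

theorem locFrac_self (I : Ideal (R K n)) (p : Pn K n) {d : ℕ} {b : R K n}
    (hb hb' : b.IsHomogeneous d) (hbp : b ∉ pt p) : locFrac I p hb hb' hbp = 1 := by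
  rw [locFrac, ← map_one (Ideal.Quotient.mk _)]
  congr 1
  apply HomogeneousLocalization.val_injective
  rw [HomogeneousLocalization.val_mk, HomogeneousLocalization.val_one]
  exact Localization.mk_self (⟨b, hbp⟩ : (pt p).primeCompl)

theorem isUnit_locFrac_iff {I : Ideal (R K n)} {p : Pn K n} (hI : I ≤ pt p) {d : ℕ} {a b : R K n}
    (ha : a.IsHomogeneous d) (hb : b.IsHomogeneous d) (hbp : b ∉ pt p) :
    IsUnit (locFrac I p ha hb hbp) ↔ a ∉ pt p := by
  constructor
  · intro hu hap
    obtain ⟨s, hs⟩ := hu.exists_right_inv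
    obtain ⟨d', a', b', ha', hb', hbp', rfl⟩ := exists_eq_locFrac I p s
    have h1 : locFrac I p ((ha.mul ha').sub (hb.mul hb')) (hb.mul hb')
        (p.isPrime.mul_notMem hbp hbp') = 0 := by
      rw [locFrac_mul, ← locFrac_self I p (hb.mul hb') (hb.mul hb')
        (p.isPrime.mul_notMem hbp hbp'), ← sub_eq_zero] at hs
      rw [← hs, locFrac, locFrac, locFrac, ← map_sub]
      congr 1
      apply HomogeneousLocalization.val_injective
      rw [HomogeneousLocalization.val_sub, HomogeneousLocalization.val_mk,
        HomogeneousLocalization.val_mk, HomogeneousLocalization.val_mk]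
      rw [Localization.sub_mk, Localization.mk_eq_mk_iff, Localization.r_iff_exists]
      exact ⟨1, by simp; ring⟩
    obtain ⟨h, hhp, hh⟩ := (locFrac_eq_zero_iff I p _ _ _).1 h1
    have h2 := (p.isPrime.mem_or_mem (hI hh)).resolve_left hhp
    have h3 : b * b' ∈ pt p := by
      have := Ideal.sub_mem _ (Ideal.mul_mem_right a' _ hap) h2
      rwa [sub_sub_cancel] at this
    exact p.isPrime.mul_notMem hbp hbp' h3
  · intro hap
    refine IsUnit.of_mul_eq_one (locFrac I p hb ha hap) ?_
    rw [locFrac_mul]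
    have : ∀ (c : R K n) (hc : c.IsHomogeneous (d + d)) (hcp), c = a * b →
        locFrac I p (ha.mul hb) hc hcp = 1 := by
      rintro c hc hcp rfl
      exact locFrac_self I p _ _ _
    exact this _ _ _ (mul_comm b a)

theorem isLocalRing_localRing {I : Ideal (R K n)} {p : Pn K n} (hI : I ≤ pt p) :
    IsLocalRing (LocalRing I p) := by
  have h1 : Nontrivial (LocalRing I p) := by
    refine ⟨0, 1, fun h => ?_⟩
    have h1p : (1 : R K n) ∉ pt p := fun h => p.isPrime.ne_top ((Ideal.eq_top_iff_one _).2 h)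
    rw [← locFrac_self I p (isHomogeneous_one _ _) (isHomogeneous_one _ _) h1p, eq_comm,
      locFrac_eq_zero_iff] at h
    obtain ⟨h, hp, hh⟩ := h
    rw [mul_one] at hh
    exact hp (hI hh)
  exact IsLocalRing.of_surjective' (Ideal.Quotient.mk _) Ideal.Quotient.mk_surjective

theorem vcomp_smul_of_isHomogeneous {m d : ℕ} {v : Fin m → S K} (hv : ∀ j, (v j).IsHomogeneous d)
    (e : ℕ) (f : S K) : vcomp (e + d) (f • v) = homogeneousComponent e f • v := by
  ext1 j
  exact homogeneousComponent_mul_of_isHomogeneous (hv j) e f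

/-- At each point of the line, the linear part of a rope is locally saturated. -/
theorem IsRope.exists_smul_mem {I : Ideal (R K n)} {e : ℕ} (hI : IsRope I e)
    (q : ProjectiveSpectrum (homogeneousSubmodule (Fin 2) K)) {d : ℕ} {v : Fin (n - 1) → S K}
    (hv : ∀ j, (v j).IsHomogeneous d) {f : S K} (hf : f ≠ 0) (hfv : f • v ∈ linearPart I) :
    ∃ h ∉ lpt q, h • v ∈ linearPart I := by
  by_cases hfq : f ∈ lpt q
  swap
  · exact ⟨f, hfq, hfv⟩
  obtain ⟨i, hi⟩ := exists_X_notMem q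
  have hqp := q.isPrime
  obtain ⟨dg, g, hg, hq⟩ := exists_eq_span_singleton (lpt q) q.asHomogeneousIdeal.isHomogeneous hi
  have hg0 : g ≠ 0 := by
    rintro rfl
    rw [hq, Ideal.mem_span_singleton, zero_dvd_iff] at hfq
    exact hf hfq
  have hgq : g ∈ lpt q := by rw [hq]; exact Ideal.mem_span_singleton_self g
  have hgu : ¬ IsUnit g := fun hu => hqp.ne_top (Ideal.eq_top_of_isUnit_mem _ hgq hu)
  let p := linePoint n q
  have hIp : I ≤ pt p := (hI.support p).2 (lineIdeal_le_linePoint q)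
  have hIL := hI.le_lineIdeal
  have := isLocalRing_localRing hIp
  have hX : ∀ N : ℕ, incl K n (X i ^ N) ∉ pt p := fun N h => by
    rw [mem_linePoint, restr_incl] at h
    exact hi (hqp.mem_of_pow_mem _ h)
  have hXh : ∀ N : ℕ, (incl K n (X i ^ N)).IsHomogeneous N := fun N =>
    incl_isHomogeneous (isHomogeneous_X_pow _ _)
  -- The fraction `g / X_i^{dg}` certifies positive dimension: `g` vanishes at the point, but no
  -- power of `g` vanishes on `L`, and `I ⊆ I_L`.
  obtain ⟨r, hr, hru⟩ := (hI.locallyCM p hIp).exists_regular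
    (r₀ := locFrac I p (incl_isHomogeneous hg) (hXh dg) (hX dg))
    (by
      rw [isUnit_locFrac_iff hIp, not_not, mem_linePoint, restr_incl]
      exact hgq)
    (by
      rintro ⟨N, hN⟩
      rw [locFrac_pow, locFrac_eq_zero_iff] at hN
      obtain ⟨h, hhp, hh⟩ := hN
      have h1 := mem_lineIdeal_iff.1 (hIL hh)
      rw [map_mul, map_pow, restr_incl] at h1
      rcases mul_eq_zero.1 h1 with h2 | h2
      · exact hhp (by rw [mem_linePoint, h2]; exact Ideal.zero_mem _)
      · exact hg0 (eq_zero_of_pow_eq_zero h2))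
  obtain ⟨da, a, b, ha, hb, hbp, rfl⟩ := exists_eq_locFrac I p r
  rw [isUnit_locFrac_iff hIp, not_not, mem_linePoint, hq, Ideal.mem_span_singleton] at hru
  obtain ⟨c, hc⟩ := hru
  -- With `a` restricting to `g c`, the product `f' a^s [x] v` lies in `I`, because `f' (g c)^s v =
  -- c^s f v`. As `f'` is a unit at the point and `a / b` is regular, `[x] v` vanishes in the local
  -- ring.
  obtain ⟨s, f', hf', hff'⟩ : ∃ s f', f = g ^ s * f' ∧ ¬ g ∣ f' :=
    ⟨_, (FiniteMultiplicity.of_not_isUnit hgu hf).exists_eq_pow_mul_and_not_dvd⟩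
  have hf'q : f' ∉ lpt q := by rwa [hq, Ideal.mem_span_singleton]
  have hz : locFrac I p (xdot_isHomogeneous hv) (hXh (d + 1)) (hX (d + 1)) = 0 := by
    refine (hr.pow s) ?_
    simp only [smul_eq_mul, mul_zero]
    rw [locFrac_pow, locFrac_mul, locFrac_eq_zero_iff]
    refine ⟨incl K n f', by rwa [mem_linePoint, restr_incl], ?_⟩
    rw [← mul_assoc, mul_xdot_mem_iff hI.sq_le, map_mul, map_pow, restr_incl, hc]
    have : (f' * (g * c) ^ s) • v = c ^ s • (f • v) := by
      rw [smul_smul, hf']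
      congr 1
      ring
    rw [this]
    exact Submodule.smul_mem _ _ hfv
  obtain ⟨h, hhp, hh⟩ := (locFrac_eq_zero_iff I p _ _ _).1 hz
  exact ⟨restr K n h, hhp, (mul_xdot_mem_iff hI.sq_le _ _).1 hh⟩

/-- Saturation of `I` asks for products with all variables, but `x_j` times a linear form is already
in `I_L² ⊆ I`. Only `t` and `u` remain. -/
theorem IsRope.mem_of_X_smul_mem {I : Ideal (R K n)} {e : ℕ} (hI : IsRope I e)
    {v : Fin (n - 1) → S K} (hv : ∀ i, (X i : S K) • v ∈ linearPart I) : v ∈ linearPart I := by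
  refine hI.saturated _ ?_
  rintro (j | i)
  · apply hI.sq_le
    rw [pow_two]
    exact Ideal.mul_mem_mul (x_mem_lineIdeal j) (xdot_mem_lineIdeal v)
  · have h := hv i
    rw [mem_linearPart, xdot_smul] at h
    simpa [incl] using h

/-- Multiplying `v` by `t` or by `u` lowers one of the two exponents and keeps the other, so
induction on `a + b` applies to both multiples. -/
theorem IsRope.mem_of_X_pow_smul_mem {I : Ideal (R K n)} {e : ℕ} (hI : IsRope I e) (N : ℕ) :
    ∀ (a b : ℕ) (v : Fin (n - 1) → S K), a + b ≤ N → (X 0 ^ a : S K) • v ∈ linearPart I →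
      (X 1 ^ b : S K) • v ∈ linearPart I → v ∈ linearPart I := by
  induction N with
  | zero =>
    intro a b v hab ha hb
    obtain rfl : a = 0 := by omega
    simpa using ha
  | succ N ih =>
    intro a b v hab ha hb
    rcases a with _ | a
    · simpa using ha
    rcases b with _ | b
    · simpa using hb
    refine hI.mem_of_X_smul_mem fun i => ?_
    fin_cases i
    · refine ih a (b + 1) _ (by omega) ?_ ?_
      · rw [smul_smul]
        exact ha
      · rw [smul_comm]
        exact Submodule.smul_mem _ _ hb
    · refine ih (a + 1) b _ (by omega) ?_ ?_
      · rw [smul_comm]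
        exact Submodule.smul_mem _ _ ha
      · rw [smul_smul]
        exact hb

/-- The quotient of `S ^ {r+1}` by the linear part of a rope has no homogeneous torsion. -/
theorem IsRope.mem_of_smul_mem {I : Ideal (R K n)} {e : ℕ} (hI : IsRope I e) {d : ℕ}
    {v : Fin (n - 1) → S K} (hv : ∀ j, (v j).IsHomogeneous d) {f : S K} (hf : f ≠ 0)
    (hfv : f • v ∈ linearPart I) : v ∈ linearPart I := by
  -- The ideal of multipliers of `v` into the linear part: homogeneous because `v` is, and without
  -- zeros on `L` by `exists_smul_mem`.
  let J : Ideal (S K) := (linearPart I).comap (LinearMap.toSpanSingleton (S K) _ v)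
  have hJ : ∀ h, h ∈ J ↔ h • v ∈ linearPart I := fun h => Iff.rfl
  have hX := exists_X_pow_mem (J := J)
    (fun h hh c => by
      rw [hJ] at hh ⊢
      rw [← vcomp_smul_of_isHomogeneous hv]
      exact linearPart_isGraded hI.homogeneous _ hh _)
    (fun q => by
      obtain ⟨h, hq, hh⟩ := hI.exists_smul_mem q hv hf hfv
      exact ⟨h, hh, hq⟩)
  obtain ⟨a, ha⟩ := hX 0
  obtain ⟨b, hb⟩ := hX 1
  exact hI.mem_of_X_pow_smul_mem (a + b) a b v le_rfl ha hb

/-! ### Matrices over a commutative ring -/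

/-- If `A` has a right inverse then its maximal minors are not all in a given proper ideal. -/
theorem exists_minor_notMem {T : Type*} [CommRing T] {a m : ℕ} {A : Matrix (Fin a) (Fin m) T}
    {C : Matrix (Fin m) (Fin a) T} (h : A * C = 1) {P : Ideal T} (hP : P ≠ ⊤) :
    ∃ J : Fin a ↪o Fin m, (A.submatrix id J).det ∉ P := by
  by_contra! hJ
  -- From increasing to arbitrary choices of columns: sorting changes only the sign, and a repeated
  -- column makes the determinant zero.
  have key : ∀ r : Fin a → Fin m, (A.submatrix id r).det ∈ P := by
    intro r
    by_cases hr : Function.Injective r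
    · have hmono : StrictMono (r ∘ Tuple.sort r) :=
        (Tuple.monotone_sort r).strictMono_of_injective
          (hr.comp (Tuple.sort r).injective)
      have h1 := hJ (OrderEmbedding.ofStrictMono _ hmono)
      have h2 : A.submatrix id (OrderEmbedding.ofStrictMono _ hmono) =
          (A.submatrix id r).submatrix id (Tuple.sort r) := rfl
      rw [h2, Matrix.det_permute'] at h1
      have h3 := P.mul_mem_left ((Equiv.Perm.sign (Tuple.sort r) : ℤ) : T) h1
      rw [← mul_assoc, ← Int.cast_mul, ← Units.val_mul, Int.units_mul_self] at h3
      simpa using h3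
    · rw [Function.Injective] at hr
      push Not at hr
      obtain ⟨i, j, hij, hne⟩ := hr
      rw [Matrix.det_zero_of_column_eq hne (fun k => by simp [hij])]
      exact P.zero_mem
  refine hP ((Ideal.eq_top_iff_one _).2 ?_)
  -- As in the Cauchy-Binet formula, the columns of `A * C` are combinations of columns of `A`.
  -- Multilinear expansion writes `det (A * C) = 1` through the determinants in `key`.
  have h1 : (1 : T) = Matrix.detRowAlternating fun i => ∑ j, C j i • fun k => A k j := by
    rw [← Matrix.det_one (n := Fin a), ← h, ← Matrix.det_transpose]
    change Matrix.det _ = Matrix.det _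
    congr 1
    ext i k
    simp [Matrix.mul_apply, mul_comm]
  rw [h1]
  have h2 := MultilinearMap.map_sum
    (Matrix.detRowAlternating (n := Fin a) (R := T)).toMultilinearMap
    (fun i j => C j i • fun k => A k j)
  rw [AlternatingMap.coe_multilinearMap] at h2
  rw [h2]
  refine Ideal.sum_mem _ fun r _ => ?_
  have h3 := MultilinearMap.map_smul_univ
    (Matrix.detRowAlternating (n := Fin a) (R := T)).toMultilinearMap
    (fun i => C (r i) i) (fun i k => A k (r i))
  rw [AlternatingMap.coe_multilinearMap] at h3
  rw [h3]
  refine P.mul_mem_left _ ?_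
  have h4 := key r
  rw [← Matrix.det_transpose] at h4
  exact h4

theorem mulVec_surjective_of_isUnit_minor {T : Type*} [CommRing T] {a m : ℕ}
    {A : Matrix (Fin a) (Fin m) T} {J : Fin a ↪o Fin m} (h : IsUnit (A.submatrix id J).det) :
    Function.Surjective A.mulVec := by
  rw [Matrix.mulVec_surjective_iff_exists_right_inverse]
  refine ⟨(1 : Matrix (Fin m) (Fin m) T).submatrix id J * (A.submatrix id J)⁻¹, ?_⟩
  rw [← Matrix.mul_assoc]
  have : A * (1 : Matrix (Fin m) (Fin m) T).submatrix id J = A.submatrix id J := by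
    ext i j
    simp [Matrix.mul_apply, Matrix.one_apply]
  rw [this, Matrix.mul_nonsing_inv _ h]

theorem exists_clear_denominators {T Q : Type*} [CommRing T] [CommRing Q] [Algebra T Q]
    (M : Submonoid T) [IsLocalization M Q] {m : ℕ} (v : Fin m → Q) :
    ∃ s ∈ M, ∃ w : Fin m → T, ∀ i, algebraMap T Q s * v i = algebraMap T Q (w i) := by
  obtain ⟨s, hs⟩ := IsLocalization.exist_integer_multiples_of_finite M v
  choose w hw using hs
  exact ⟨s, s.2, w, fun i => by rw [hw, Algebra.smul_def]⟩

theorem map_mulVec_algebraMap {T Q : Type*} [CommRing T] [CommRing Q] [Algebra T Q] {a m : ℕ}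
    (A : Matrix (Fin a) (Fin m) T) (v : Fin m → T) (i : Fin a) :
    (A.map (algebraMap T Q)).mulVec (fun j => algebraMap T Q (v j)) i =
      algebraMap T Q (A.mulVec v i) := by
  simp [Matrix.mulVec, dotProduct]

theorem smul_mulVec_eq {T : Type*} [CommRing T] {a m : ℕ}
    (A : Matrix (Fin a) (Fin m) T) (s : T) (v : Fin m → T) (i : Fin a) :
    A.mulVec (fun j => s * v j) i = s * A.mulVec v i := by
  change A.mulVec (s • v) i = s • A.mulVec v i
  rw [Matrix.mulVec_smul]
  rfl

/-! ### Saturated graded submodules of `S ^ m` -/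

/-- The annihilator of a submodule of `S ^ m` under the dot product. -/
def perp {m : ℕ} (N : Submodule (S K) (Fin m → S K)) : Submodule (S K) (Fin m → S K) where
  carrier := {a | ∀ v ∈ N, a ⬝ᵥ v = 0}
  zero_mem' := fun v _ => by simp
  add_mem' := fun ha hb v hv => by rw [add_dotProduct, ha v hv, hb v hv, add_zero]
  smul_mem' := fun c a ha v hv => by rw [smul_dotProduct, ha v hv, smul_zero]

theorem homogeneousComponent_dotProduct {m e : ℕ} {v : Fin m → S K}
    (hv : ∀ j, (v j).IsHomogeneous e) (a : Fin m → S K) (d : ℕ) :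
    homogeneousComponent (d + e) (a ⬝ᵥ v) = vcomp d a ⬝ᵥ v := by
  simp only [dotProduct, map_sum]
  exact Finset.sum_congr rfl fun j _ => homogeneousComponent_mul_of_isHomogeneous (hv j) d _

theorem perp_isGraded {m : ℕ} {N : Submodule (S K) (Fin m → S K)} (hN : IsGraded N) :
    IsGraded (perp N) := fun a ha d v hv => by
  obtain ⟨D, hD⟩ := exists_sum_vcomp v
  rw [← hD, dotProduct_sum]
  refine Finset.sum_eq_zero fun e _ => ?_
  rw [← homogeneousComponent_dotProduct (vcomp_isHomogeneous e v), ha _ (hN v hv e), map_zero]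

theorem mem_perp_of_smul_mem {m : ℕ} {N : Submodule (S K) (Fin m → S K)} {a : Fin m → S K}
    {f : S K} (hf : f ≠ 0) (h : f • a ∈ perp N) : a ∈ perp N := fun v hv => by
  have := h v hv
  rw [smul_dotProduct, smul_eq_mul] at this
  exact (mul_eq_zero.1 this).resolve_left hf

/-- Passes from homogeneous vectors, where torsion-freeness is known, to the saturation that
`exists_homogeneous_basis` needs. -/
theorem mem_of_X_smul_mem_of_isGraded {m : ℕ} {N : Submodule (S K) (Fin m → S K)}
    (hN : IsGraded N)
    (htf : ∀ (d : ℕ) (v : Fin m → S K), (∀ j, (v j).IsHomogeneous d) → ∀ f : S K, f ≠ 0 →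
      f • v ∈ N → v ∈ N) (i : Fin 2) (v : Fin m → S K) (h : (X i : S K) • v ∈ N) : v ∈ N := by
  obtain ⟨D, hD⟩ := exists_sum_vcomp v
  rw [← hD]
  refine Submodule.sum_mem _ fun d _ => htf d _ (vcomp_isHomogeneous d v) (X i) (X_ne_zero i) ?_
  have h1 := hN _ h (d + 1)
  have h2 : vcomp (d + 1) ((X i : S K) • v) = (X i : S K) • vcomp d v := by
    ext1 j
    simp only [vcomp, Pi.smul_apply, smul_eq_mul]
    rw [mul_comm, homogeneousComponent_mul_of_isHomogeneous (isHomogeneous_X K i), mul_comm]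
  rwa [h2] at h1

/-- A vector that is orthogonal to the annihilator of `N` has a nonzero multiple in `N`. -/
theorem exists_smul_mem_of_perp {m : ℕ} {N : Submodule (S K) (Fin m → S K)} {v : Fin m → S K}
    (hv : ∀ a ∈ perp N, a ⬝ᵥ v = 0) : ∃ f : S K, f ≠ 0 ∧ f • v ∈ N := by
  let F := FractionRing (S K)
  let ι : (Fin m → S K) → Fin m → F := fun w j => algebraMap (S K) F (w j)
  have hinj := IsFractionRing.injective (S K) F
  -- Over the field `F`, a vector outside the span is separated from it by a linear form. The form
  -- with cleared denominators lies in `perp N` and does not kill `v`.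
  have hmem : ι v ∈ Submodule.span F (ι '' N) := by
    by_contra hnot
    obtain ⟨φ, hφv, hφN⟩ := Submodule.exists_le_ker_of_notMem hnot
    obtain ⟨s, hs, w, hw⟩ := exists_clear_denominators (nonZeroDivisors (S K))
      (fun j => φ (Pi.single j 1))
    have hφ : ∀ u : Fin m → S K, algebraMap (S K) F s * φ (ι u) =
        algebraMap (S K) F (w ⬝ᵥ u) := by
      intro u
      have h1 : ι u = ∑ j, algebraMap (S K) F (u j) • Pi.single j (1 : F) := by
        ext i
        simp only [ι, Finset.sum_apply, Pi.smul_apply, Pi.single_apply, smul_eq_mul, mul_ite,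
          mul_one, mul_zero, Finset.sum_ite_eq, Finset.mem_univ, if_true]
      rw [h1, map_sum, Finset.mul_sum, dotProduct, map_sum]
      refine Finset.sum_congr rfl fun j _ => ?_
      rw [map_smul, smul_eq_mul, map_mul, ← hw]
      ring
    have hwp : w ∈ perp N := fun u hu => by
      apply hinj
      have h2 : φ (ι u) = 0 := hφN (Submodule.subset_span ⟨u, hu, rfl⟩)
      rw [← hφ, h2, mul_zero, map_zero]
    have h3 := hφ v
    rw [hv w hwp, map_zero] at h3
    rcases mul_eq_zero.1 h3 with h4 | h4
    · rw [map_eq_zero_iff _ hinj] at h4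
      exact nonZeroDivisors.ne_zero hs h4
    · exact hφv h4
  have key : ∀ y ∈ Submodule.span F (ι '' N), ∃ f : S K, f ≠ 0 ∧ ∃ w ∈ N,
      ∀ j, algebraMap (S K) F f * y j = algebraMap (S K) F (w j) := by
    intro y hy
    induction hy using Submodule.span_induction with
    | mem y hy =>
      obtain ⟨w, hw, rfl⟩ := hy
      exact ⟨1, one_ne_zero, w, hw, fun j => by simp [ι]⟩
    | zero => exact ⟨1, one_ne_zero, 0, N.zero_mem, fun j => by simp⟩
    | add y y' _ _ h h' =>
      obtain ⟨f, hf, w, hw, e⟩ := h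
      obtain ⟨f', hf', w', hw', e'⟩ := h'
      refine ⟨f * f', mul_ne_zero hf hf', f' • w + f • w',
        N.add_mem (N.smul_mem _ hw) (N.smul_mem _ hw'), fun j => ?_⟩
      simp only [Pi.add_apply, Pi.smul_apply, smul_eq_mul, map_add, map_mul, ← e, ← e']
      ring
    | smul r y _ h =>
      obtain ⟨f, hf, w, hw, e⟩ := h
      obtain ⟨a, b, hb, rfl⟩ := IsFractionRing.div_surjective (A := S K) r
      refine ⟨b * f, mul_ne_zero (nonZeroDivisors.ne_zero hb) hf, a • w, N.smul_mem _ hw,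
        fun j => ?_⟩
      have hb0 : algebraMap (S K) F b ≠ 0 := fun h =>
        nonZeroDivisors.ne_zero hb ((map_eq_zero_iff _ hinj).1 h)
      simp only [Pi.smul_apply, smul_eq_mul, map_mul, ← e]
      have h1 := mul_div_cancel₀ (algebraMap (S K) F a) hb0
      linear_combination algebraMap (S K) F f * y j * h1
  obtain ⟨f, hf, w, hw, e⟩ := key _ hmem
  refine ⟨f, hf, ?_⟩
  have : f • v = w := by
    ext1 j
    apply hinj
    rw [← e j, Pi.smul_apply, smul_eq_mul, map_mul]
  rwa [this]

theorem algebraMap_localization_injective (q : Ideal (S K)) [q.IsPrime] :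
    Function.Injective (algebraMap (S K) (Localization.AtPrime q)) :=
  IsLocalization.injective _ q.primeCompl_le_nonZeroDivisors

theorem algebraMap_localization_ne_zero (q : Ideal (S K)) [q.IsPrime] {s : S K} (hs : s ∉ q) :
    IsUnit (algebraMap (S K) (Localization.AtPrime q) s) :=
  IsLocalization.map_units (Localization.AtPrime q) (⟨s, hs⟩ : q.primeCompl)

theorem mulVec_injective_localization {m k : ℕ} {B : Matrix (Fin m) (Fin k) (S K)}
    (hB : ∀ c, B.mulVec c = 0 → c = 0) (q : Ideal (S K)) [q.IsPrime] :
    Function.Injective (B.map (algebraMap (S K) (Localization.AtPrime q))).mulVec := by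
  have h0 : ∀ c, (B.map (algebraMap (S K) (Localization.AtPrime q))).mulVec c = 0 → c = 0 := by
    intro c hc
    obtain ⟨s, hs, w, hw⟩ := exists_clear_denominators q.primeCompl c
    have h1 : B.mulVec w = 0 := by
      ext1 i
      apply algebraMap_localization_injective q
      rw [← map_mulVec_algebraMap, ← funext hw, smul_mulVec_eq, hc]
      simp
    ext1 i
    have h2 := hw i
    rw [hB w h1, Pi.zero_apply, map_zero] at h2
    exact (algebraMap_localization_ne_zero q hs).mul_right_eq_zero.1 h2
  intro c c' h
  rw [← sub_eq_zero]
  apply h0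
  rw [Matrix.mulVec_sub, sub_eq_zero]
  exact h

/-- Flatness of localization, done by hand: clear denominators of `v`, lift over `S`, divide again.
-/
theorem exact_localization {a m k : ℕ} {A : Matrix (Fin a) (Fin m) (S K)}
    {B : Matrix (Fin m) (Fin k) (S K)} (h : ∀ v, A.mulVec v = 0 ↔ ∃ c, B.mulVec c = v)
    (q : Ideal (S K)) [q.IsPrime] :
    Function.Exact (B.map (algebraMap (S K) (Localization.AtPrime q))).mulVec
      (A.map (algebraMap (S K) (Localization.AtPrime q))).mulVec := by
  intro v
  constructor
  · intro hv
    obtain ⟨s, hs, w, hw⟩ := exists_clear_denominators q.primeCompl v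
    have h1 : A.mulVec w = 0 := by
      ext1 i
      apply algebraMap_localization_injective q
      rw [← map_mulVec_algebraMap, ← funext hw, smul_mulVec_eq, hv]
      simp
    obtain ⟨c, hc⟩ := (h w).1 h1
    obtain ⟨u, hu⟩ := (algebraMap_localization_ne_zero q hs).exists_left_inv
    refine ⟨fun l => u * algebraMap _ _ (c l), ?_⟩
    ext1 i
    rw [smul_mulVec_eq, map_mulVec_algebraMap, hc, ← hw, ← mul_assoc, hu, one_mul]
  · rintro ⟨c, rfl⟩
    have hAB : A * B = 0 := by
      refine Matrix.ext fun i l => ?_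
      have h1 := (h (B.mulVec (Pi.single l 1))).2 ⟨_, rfl⟩
      rw [Matrix.mulVec_mulVec] at h1
      simpa using congrFun h1 i
    rw [Matrix.mulVec_mulVec, ← Matrix.map_mul, hAB]
    simp

/-- The rows of a basis of the annihilator give a locally surjective matrix. -/
theorem exists_minor_notMem_of_perp {m a : ℕ} {N : Submodule (S K) (Fin m → S K)}
    {A : Matrix (Fin a) (Fin m) (S K)} (hli : LinearIndependent (S K) A.row)
    (hsp : Submodule.span (S K) (Set.range A.row) = perp N)
    (q : ProjectiveSpectrum (homogeneousSubmodule (Fin 2) K)) :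
    ∃ J : Fin a ↪o Fin m, (A.submatrix id J).det ∉ lpt q := by
  have hqp := q.isPrime
  obtain ⟨i, hi⟩ := exists_X_notMem q
  obtain ⟨dg, g, hg, hq⟩ := exists_eq_span_singleton (lpt q) q.asHomogeneousIdeal.isHomogeneous hi
  have hinj : ∀ c, Matrix.vecMul c A = 0 → c = 0 := by
    intro c hc
    have := Matrix.vecMul_injective_iff.2 hli
    exact this (a₂ := 0) (by simpa using hc)
  -- Independence of the rows modulo `q = (g)`. If `c A = g w`, then `w` is in the saturated module
  -- `perp N`, so `w = c' A` and `c = g c'`. For `g = 0` this is independence over `S`.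
  have key : ∀ c : Fin a → S K, (∀ j, Matrix.vecMul c A j ∈ lpt q) → ∀ i, c i ∈ lpt q := by
    intro c hc
    simp only [hq, Ideal.mem_span_singleton] at hc ⊢
    choose w hw using hc
    have hcA : Matrix.vecMul c A = g • w := funext hw
    by_cases hg0 : g = 0
    · rw [hg0, zero_smul] at hcA
      rw [hinj c hcA]
      simp
    · have hcp : Matrix.vecMul c A ∈ perp N := by
        rw [← hsp, Matrix.vecMul_eq_sum]
        exact Submodule.sum_mem _ fun i _ => Submodule.smul_mem _ _
          (Submodule.subset_span ⟨i, rfl⟩)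
      rw [hcA] at hcp
      have hwp := mem_perp_of_smul_mem hg0 hcp
      rw [← hsp, Submodule.mem_span_range_iff_exists_fun] at hwp
      obtain ⟨c', hc'⟩ := hwp
      have h1 : w = Matrix.vecMul c' A := by
        rw [← hc', Matrix.vecMul_eq_sum]
        rfl
      have h2 := hinj (c - g • c') (by
        rw [Matrix.sub_vecMul, Matrix.smul_vecMul, ← h1, hcA, sub_self])
      intro i
      exact ⟨c' i, by simpa [sub_eq_zero] using congrFun h2 i⟩
  let κ := FractionRing (S K ⧸ lpt q)
  let φ : S K →+* κ := (algebraMap (S K ⧸ lpt q) κ).comp (Ideal.Quotient.mk (lpt q))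
  have hφ : ∀ f, φ f = 0 ↔ f ∈ lpt q := fun f => by
    rw [RingHom.comp_apply, map_eq_zero_iff _ (IsFractionRing.injective (S K ⧸ lpt q) κ),
      Ideal.Quotient.eq_zero_iff_mem]
  -- Over the fraction field `κ` of `S / q`, independent rows yield a right inverse of `A`, hence a
  -- maximal minor that is nonzero in `κ`.
  have hinjκ : ∀ c : Fin a → κ, Matrix.vecMul c (A.map φ) = 0 → c = 0 := by
    intro c hc
    obtain ⟨s, hs, w, hw⟩ := exists_clear_denominators (nonZeroDivisors (S K ⧸ lpt q)) c
    choose w' hw' using fun i => Ideal.Quotient.mk_surjective (w i)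
    have h1 : ∀ j, Matrix.vecMul w' A j ∈ lpt q := by
      intro j
      rw [← hφ]
      have h2 := congrFun hc j
      simp only [Matrix.vecMul, dotProduct, Matrix.map_apply, Pi.zero_apply] at h2 ⊢
      rw [map_sum, ← mul_zero (algebraMap _ κ s), ← h2, Finset.mul_sum]
      refine Finset.sum_congr rfl fun i _ => ?_
      rw [map_mul, ← mul_assoc, hw, ← hw']
      rfl
    ext1 i
    have h3 := hw i
    rw [← hw', Ideal.Quotient.eq_zero_iff_mem.2 (key w' h1 i), map_zero] at h3
    refine (mul_eq_zero.1 h3).resolve_left fun h4 => ?_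
    rw [map_eq_zero_iff _ (IsFractionRing.injective (S K ⧸ lpt q) κ)] at h4
    exact nonZeroDivisors.ne_zero hs h4
  obtain ⟨g, hg⟩ := LinearMap.exists_leftInverse_of_injective (Matrix.vecMulLinear (A.map φ))
    (LinearMap.ker_eq_bot'.2 hinjκ)
  have hAC : A.map φ * (LinearMap.toMatrix' g).transpose = 1 := by
    refine Matrix.ext_iff_vecMul.2 ?_
    intro c
    rw [← Matrix.vecMul_vecMul, Matrix.vecMul_transpose, LinearMap.toMatrix'_mulVec,
      Matrix.vecMul_one]
    exact LinearMap.congr_fun hg c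
  obtain ⟨J, hJ⟩ := exists_minor_notMem hAC (bot_ne_top : (⊥ : Ideal κ) ≠ ⊤)
  refine ⟨J, fun h => hJ ?_⟩
  rw [Ideal.mem_bot, Matrix.submatrix_map, ← RingHom.mapMatrix_apply, ← RingHom.map_det]
  exact (hφ _).2 h

/-! ### Hilbert functions -/

theorem finrank_homogeneousSubmodule (d : ℕ) :
    Module.finrank K (homogeneousSubmodule (Fin 2) K d) = d + 1 := by
  let e : Fin (d + 1) → (Fin 2 →₀ ℕ) := fun i => Finsupp.single 0 (i : ℕ) + Finsupp.single 1 (d - i)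
  have he : Function.Injective e := fun i j h => by
    have := DFunLike.congr_fun h 0
    simp [e] at this
    exact Fin.ext this
  have hdeg : ∀ i, (e i).degree = d := fun i => by
    have := i.2
    simp only [e, map_add, Finsupp.degree_single]
    omega
  have hli : LinearIndependent K fun i => (monomial (e i) (1 : K) : S K) := by
    have := (basisMonomials (Fin 2) K).linearIndependent.comp e he
    simpa [Function.comp_def] using this
  have hsp : Submodule.span K (Set.range fun i => (monomial (e i) (1 : K) : S K)) =
      homogeneousSubmodule (Fin 2) K d := by
    apply le_antisymm
    · rw [Submodule.span_le]
      rintro _ ⟨i, rfl⟩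
      exact isHomogeneous_monomial _ (hdeg i)
    · intro f hf
      rw [f.as_sum]
      refine Submodule.sum_mem _ fun m hm => ?_
      have hmd : m.degree = d := by
        by_contra hne
        exact (mem_support_iff.1 hm) (IsHomogeneous.coeff_eq_zero hf hne)
      rw [Finsupp.degree_eq_sum, Fin.sum_univ_two] at hmd
      have hme : e ⟨m 0, by omega⟩ = m := by
        ext a
        fin_cases a
        · simp [e]
        · simp [e]; omega
      rw [← mul_one (coeff m f), ← smul_eq_mul, ← smul_monomial]
      refine Submodule.smul_mem _ _ (Submodule.subset_span ⟨⟨m 0, by omega⟩, ?_⟩)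
      simp only [hme]
  rw [← hsp, finrank_span_eq_card hli, Fintype.card_fin]

instance finite_homogeneousSubmodule (d : ℕ) :
    Module.Finite K (homogeneousSubmodule (Fin 2) K d) :=
  Module.Finite.iff_fg.2 (homogeneousSubmodule_fg (R := K) (σ := Fin 2) d)

/-- The map `(P, v) ↦ P + [x₀, …, xᵣ] v` to `R / I`. -/
def expand (I : Ideal (R K n)) (d : ℕ) :
    (homogeneousSubmodule (Fin 2) K (d + 1) × (Fin (n - 1) → homogeneousSubmodule (Fin 2) K d))
      →ₗ[K] R K n ⧸ I where
  toFun y := Ideal.Quotient.mk I (incl K n y.1 + xdot K n fun j => (y.2 j : S K))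
  map_add' y z := by
    have : (fun j => ((y + z).2 j : S K)) = (fun j => (y.2 j : S K)) + fun j => (z.2 j : S K) := rfl
    rw [this, ← map_add (Ideal.Quotient.mk I)]
    congr 1
    rw [Prod.fst_add, Submodule.coe_add, map_add, map_add]
    ring
  map_smul' c y := by
    have : (fun j => ((c • y).2 j : S K)) = (C c : S K) • fun j => (y.2 j : S K) := by
      ext1 j
      simp [smul_eq_C_mul]
    rw [this, xdot_smul, RingHom.id_apply, ← Ideal.Quotient.mkₐ_eq_mk K I, ← map_smul]
    congr 1
    rw [Prod.smul_fst, Submodule.coe_smul, smul_add, map_smul, smul_eq_C_mul, smul_eq_C_mul]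
    simp [incl]

theorem range_expand {I : Ideal (R K n)} (h2 : lineIdeal K n ^ 2 ≤ I) (d : ℕ) :
    LinearMap.range (expand I d) = (homogeneousSubmodule (Fin (n - 1) ⊕ Fin 2) K (d + 1)).map
      (Ideal.Quotient.mkₐ K I).toLinearMap := by
  apply le_antisymm
  · rintro _ ⟨y, rfl⟩
    exact ⟨_, (incl_isHomogeneous y.1.2).add (xdot_isHomogeneous fun j => (y.2 j).2), rfl⟩
  · rintro _ ⟨f, hf, rfl⟩
    have hf : f.IsHomogeneous (d + 1) := hf
    refine ⟨(⟨restr K n f, restr_isHomogeneous hf⟩, fun j => ⟨lin j f, lin_isHomogeneous hf j⟩), ?_⟩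
    change Ideal.Quotient.mk I _ = Ideal.Quotient.mk I f
    rw [eq_comm, Ideal.Quotient.eq, ← sub_sub]
    exact h2 (sub_restr_sub_lin_mem f)

/-- The relations among the generators of degree `d + 1` of `R / I`. -/
def relations {k : ℕ} (β : Fin k → ℕ) (b : Fin k → Fin (n - 1) → S K)
    (hb : ∀ l j, (b l j).IsHomogeneous (β l)) (d : ℕ) (hd : ∀ l, β l ≤ d) :
    ((l : Fin k) → homogeneousSubmodule (Fin 2) K (d - β l)) →ₗ[K]
      (homogeneousSubmodule (Fin 2) K (d + 1) × (Fin (n - 1) → homogeneousSubmodule (Fin 2) K d))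
    where
  toFun c := (0, fun j => ⟨∑ l, (c l : S K) * b l j, IsHomogeneous.sum _ _ _ fun l _ => by
    have := IsHomogeneous.mul (c l).2 (hb l j)
    rwa [Nat.sub_add_cancel (hd l)] at this⟩)
  map_add' c c' := by
    ext1
    · simp
    · ext1 j
      apply Subtype.ext
      simp [add_mul, Finset.sum_add_distrib]
  map_smul' r c := by
    ext1
    · simp
    · ext1 j
      apply Subtype.ext
      simp [Finset.smul_sum]

/-- The kernel consists of the degree `d` vectors of the linear part. The coefficient of `b l` in
such a vector may be replaced by its component of degree `d - β l`. -/
theorem range_relations {I : Ideal (R K n)} (h2 : lineIdeal K n ^ 2 ≤ I) (h1 : I ≤ lineIdeal K n)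
    {k : ℕ} (β : Fin k → ℕ) (b : Fin k → Fin (n - 1) → S K)
    (hb : ∀ l j, (b l j).IsHomogeneous (β l))
    (hsp : Submodule.span (S K) (Set.range b) = linearPart I) (d : ℕ) (hd : ∀ l, β l ≤ d) :
    LinearMap.range (relations β b hb d hd) = LinearMap.ker (expand I d) := by
  have hker : ∀ y, y ∈ LinearMap.ker (expand I d) ↔
      (y.1 : S K) = 0 ∧ (fun j => (y.2 j : S K)) ∈ linearPart I := by
    intro y
    rw [LinearMap.mem_ker]
    change Ideal.Quotient.mk I _ = 0 ↔ _
    rw [Ideal.Quotient.eq_zero_iff_mem, mem_iff_linearPart h2 h1]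
    simp
  ext y
  rw [hker]
  constructor
  · rintro ⟨c, rfl⟩
    refine ⟨rfl, ?_⟩
    rw [← hsp, Submodule.mem_span_range_iff_exists_fun]
    refine ⟨fun l => c l, ?_⟩
    ext1 j
    simp [relations]
  · rintro ⟨hy1, hy2⟩
    rw [← hsp, Submodule.mem_span_range_iff_exists_fun] at hy2
    obtain ⟨c, hc⟩ := hy2
    refine ⟨fun l => ⟨homogeneousComponent (d - β l) (c l),
      homogeneousComponent_isHomogeneous _ _⟩, ?_⟩
    ext1
    · exact Subtype.ext hy1.symm
    · ext1 j
      apply Subtype.ext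
      have h3 := congrArg (homogeneousComponent d) (congrFun hc j)
      have hyj : ((y.2 j : S K)).IsHomogeneous d := (y.2 j).2
      rw [homogeneousComponent_eq_self hyj] at h3
      rw [← h3, Finset.sum_apply, map_sum]
      change ∑ l, homogeneousComponent (d - β l) (c l) * b l j = _
      refine Finset.sum_congr rfl fun l _ => ?_
      have h4 := homogeneousComponent_mul_of_isHomogeneous (hb l j) (d - β l) (c l)
      rw [Nat.sub_add_cancel (hd l)] at h4
      rw [← h4]
      rfl

theorem relations_injective {k : ℕ} (β : Fin k → ℕ) (b : Fin k → Fin (n - 1) → S K)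
    (hb : ∀ l j, (b l j).IsHomogeneous (β l)) (hli : LinearIndependent (S K) b)
    (d : ℕ) (hd : ∀ l, β l ≤ d) : Function.Injective (relations β b hb d hd) := by
  rw [← LinearMap.ker_eq_bot, LinearMap.ker_eq_bot']
  intro c hc
  ext1 l
  apply Subtype.ext
  refine Fintype.linearIndependent_iff.1 hli (fun l => (c l : S K)) ?_ l
  ext1 j
  have := congrArg (fun y => ((y.2 j : S K))) hc
  simpa [relations] using this

/-- Dimension count in `0 → ⨁ S_{d-β_l} → S_{d+1} ⊕ S_d^{n-1} → (R / I)_{d+1} → 0`. -/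
theorem finrank_add_sum {I : Ideal (R K n)} (h2 : lineIdeal K n ^ 2 ≤ I) (h1 : I ≤ lineIdeal K n)
    {k : ℕ} (β : Fin k → ℕ) (b : Fin k → Fin (n - 1) → S K)
    (hb : ∀ l j, (b l j).IsHomogeneous (β l)) (hli : LinearIndependent (S K) b)
    (hsp : Submodule.span (S K) (Set.range b) = linearPart I) (d : ℕ) (hd : ∀ l, β l ≤ d) :
    Module.finrank K ((homogeneousSubmodule (Fin (n - 1) ⊕ Fin 2) K (d + 1)).map
      (Ideal.Quotient.mkₐ K I).toLinearMap) + ∑ l, (d - β l + 1) = (d + 2) + (n - 1) * (d + 1) := by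
  have h3 := LinearMap.finrank_range_add_finrank_ker (expand I d)
  rw [← range_relations h2 h1 β b hb hsp d hd,
    LinearMap.finrank_range_of_inj (relations_injective β b hb hli d hd), range_expand h2] at h3
  simpa [Module.finrank_prod, Module.finrank_pi_fintype, finrank_homogeneousSubmodule] using h3

/-- Both sides of the dimension count are linear in `d` for large `d`. Subtracting two consecutive
instances compares the slopes. -/
theorem degree_eq {I : Ideal (R K n)} {e : ℕ} (hI : IsRope I e) {k : ℕ} (β : Fin k → ℕ)
    (b : Fin k → Fin (n - 1) → S K)
    (hb : ∀ l j, (b l j).IsHomogeneous (β l)) (hli : LinearIndependent (S K) b)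
    (hsp : Submodule.span (S K) (Set.range b) = linearPart I) : e + k = 1 + (n - 1) := by
  obtain ⟨c, hc⟩ := hI.degree
  obtain ⟨D, hD⟩ := Filter.eventually_atTop.1 hc
  -- The bound `D + ∑ β` exceeds every `β l`, so no subtraction truncates, and lies in the range of
  -- the Hilbert polynomial.
  have hβ : ∀ l, β l ≤ D + ∑ l, β l := fun l =>
    (Finset.single_le_sum (f := β) (fun _ _ => Nat.zero_le _) (Finset.mem_univ l)).trans
      (Nat.le_add_left _ _)
  have key : ∀ d, D + ∑ l, β l ≤ d →
      (e * (d + 1 : ℕ) + c : ℤ) + ∑ l, ((d : ℤ) - β l + 1) = (d + 2) + (n - 1 : ℕ) * (d + 1) := by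
    intro d hd
    have h1 := finrank_add_sum hI.sq_le hI.le_lineIdeal β b hb hli hsp d
      (fun l => (hβ l).trans hd)
    have h2 := hD (d + 1) (by omega)
    rw [← h2]
    have h3 := congrArg (Nat.cast : ℕ → ℤ) h1
    push_cast at h3 ⊢
    rw [← h3]
    congr 1
    refine Finset.sum_congr rfl fun l _ => ?_
    rw [Nat.cast_sub ((hβ l).trans hd)]
  have h1 := key (D + ∑ l, β l) le_rfl
  have h2 := key (D + ∑ l, β l + 1) (Nat.le_succ _)
  generalize D + ∑ l, β l = d at h1 h2
  simp only [Finset.sum_add_distrib, Finset.sum_sub_distrib, Finset.sum_const, Finset.card_univ,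
    Fintype.card_fin, nsmul_eq_mul] at h1 h2
  push_cast at h1 h2
  zify
  linarith

/-! ### The matrices of a rope -/

theorem add_eq_of_exact {T : Type*} [CommRing T] [IsDomain T] {a m k : ℕ}
    {A : Matrix (Fin a) (Fin m) T} {B : Matrix (Fin m) (Fin k) T}
    (hB : Function.Injective B.mulVec) (hE : Function.Exact B.mulVec A.mulVec)
    (hA : Function.Surjective A.mulVec) : a + k = m := by
  have h1 := Submodule.finrank_quotient_add_finrank (LinearMap.ker A.mulVecLin)
  have h2 : LinearMap.ker A.mulVecLin = LinearMap.range B.mulVecLin := by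
    ext v
    exact hE v
  rw [(A.mulVecLin.quotKerEquivOfSurjective hA).finrank_eq, h2,
    LinearMap.finrank_range_of_inj (f := B.mulVecLin) hB] at h1
  simpa using h1

/-- A vector killed by the annihilator of `N` has a nonzero multiple in `N`. Torsion-freeness is
available for homogeneous vectors only, so the argument runs on components. -/
theorem mulVec_eq_zero_iff_of_perp {m a : ℕ} {N : Submodule (S K) (Fin m → S K)}
    {A : Matrix (Fin a) (Fin m) (S K)} {α : Fin a → ℕ} (hα : ∀ i j, (A i j).IsHomogeneous (α i))
    (hsp : Submodule.span (S K) (Set.range A.row) = perp N)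
    (htf : ∀ (d : ℕ) (v : Fin m → S K), (∀ j, (v j).IsHomogeneous d) → ∀ f : S K, f ≠ 0 →
      f • v ∈ N → v ∈ N) (v : Fin m → S K) : A.mulVec v = 0 ↔ v ∈ N := by
  constructor
  · intro hv
    obtain ⟨D, hD⟩ := exists_sum_vcomp v
    rw [← hD]
    refine Submodule.sum_mem _ fun d _ => ?_
    have hvd : A.mulVec (vcomp d v) = 0 := by
      ext1 i
      have h1 : A.mulVec (vcomp d v) i = vcomp d v ⬝ᵥ A i := dotProduct_comm _ _
      have h2 : v ⬝ᵥ A i = 0 := (dotProduct_comm _ _).trans (congrFun hv i)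
      rw [h1, ← homogeneousComponent_dotProduct (hα i), h2, map_zero]
      rfl
    obtain ⟨f, hf, hfv⟩ := exists_smul_mem_of_perp (N := N) (v := vcomp d v) (by
      intro w hw
      rw [← hsp, Submodule.mem_span_range_iff_exists_fun] at hw
      obtain ⟨c, rfl⟩ := hw
      rw [sum_dotProduct]
      refine Finset.sum_eq_zero fun i _ => ?_
      rw [smul_dotProduct]
      have : A.row i ⬝ᵥ vcomp d v = 0 := congrFun hvd i
      rw [this, smul_zero])
    exact htf d _ (vcomp_isHomogeneous d v) f hf hfv
  · intro hv
    ext1 i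
    have : A.row i ∈ perp N := by
      rw [← hsp]
      exact Submodule.subset_span ⟨i, rfl⟩
    exact this v hv

/-- The columns of `B` are a basis of the linear part and the rows of `A` a basis of its
annihilator. The kernel statement is kept, since it gives torsion-freeness for all vectors in
`IsAssociated.mulVec_eq_zero_iff`. -/
theorem IsRope.exists_isAssociated {k : ℕ} {I : Ideal (R K n)} (hn : 2 ≤ n) (hk : k < n)
    (hI : IsRope I (n - k)) :
    ∃ (α : Fin (n - 1 - k) → ℕ) (β : Fin k → ℕ)
      (A : Matrix (Fin (n - 1 - k)) (Fin (n - 1)) (S K))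
      (B : Matrix (Fin (n - 1)) (Fin k) (S K)), IsAssociated I α β A B ∧
        ∀ v, A.mulVec v = 0 ↔ v ∈ linearPart I := by
  have hN := linearPart_isGraded hI.homogeneous
  have htf : ∀ (d : ℕ) (v : Fin (n - 1) → S K), (∀ j, (v j).IsHomogeneous d) →
      ∀ f : S K, f ≠ 0 → f • v ∈ linearPart I → v ∈ linearPart I :=
    fun d v hv f hf h => hI.mem_of_smul_mem hv hf h
  obtain ⟨k', β, b, hb, hbli, hbsp⟩ := exists_homogeneous_basis (i := 0) (linearPart I) hN
    (mem_of_X_smul_mem_of_isGraded hN htf 0)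
  obtain ⟨a', α, (A : Matrix (Fin a') (Fin (n - 1)) (S K)), hA, hAli, hAsp⟩ :=
    exists_homogeneous_basis (i := 0) (perp (linearPart I)) (perp_isGraded hN)
      fun v hv => mem_perp_of_smul_mem (X_ne_zero 0) hv
  let B : Matrix (Fin (n - 1)) (Fin k') (S K) := Matrix.of fun j l => b l j
  have hBmul : ∀ c, B.mulVec c = ∑ l, c l • b l := fun c => by
    ext1 j
    simp [B, Matrix.mulVec, dotProduct, mul_comm]
  have hker := mulVec_eq_zero_iff_of_perp (A := A) hA hAsp htf
  have hB0 : ∀ c, B.mulVec c = 0 → c = 0 := fun c hc => by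
    rw [hBmul] at hc
    exact funext (Fintype.linearIndependent_iff.1 hbli c hc)
  have hex : ∀ v, A.mulVec v = 0 ↔ ∃ c, B.mulVec c = v := fun v => by
    rw [hker, ← hbsp, Submodule.mem_span_range_iff_exists_fun]
    simp only [hBmul]
  have hsurj : ∀ q : ProjectiveSpectrum (homogeneousSubmodule (Fin 2) K), Function.Surjective
      (A.map (algebraMap (S K) (Localization.AtPrime (lpt q)))).mulVec := fun q => by
    obtain ⟨J, hJ⟩ := exists_minor_notMem_of_perp (A := A) hAli hAsp q
    apply mulVec_surjective_of_isUnit_minor (J := J)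
    rw [Matrix.submatrix_map, ← RingHom.mapMatrix_apply, ← RingHom.map_det]
    exact algebraMap_localization_ne_zero _ hJ
  -- The degree of the rope fixes the number of columns of `B`; generic exactness then fixes the
  -- number of rows of `A`.
  obtain rfl : k' = k := by
    have := degree_eq hI β b hb hbli hbsp
    omega
  have hdom : IsDomain (Localization.AtPrime (lpt (genericLine K))) :=
    IsLocalization.isDomain_localization (Ideal.primeCompl_le_nonZeroDivisors _)
  have ha := add_eq_of_exact (mulVec_injective_localization hB0 (lpt (genericLine K)))
    (exact_localization hex _) (hsurj (genericLine K))
  obtain rfl : a' = n - 1 - k' := by omega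
  refine ⟨α, β, A, B, ⟨hA, fun j l => hb l j, ?_, fun q => mulVec_injective_localization hB0 _,
    fun q => exact_localization hex _, hsurj⟩, hker⟩
  have hxb : ∀ l, xdot K n (b l) = ∑ j, x K j * incl K n (B j l) := fun l => rfl
  simp only [← hxb]
  apply le_antisymm
  · intro f hf
    obtain ⟨h0, h1⟩ := (mem_iff_linearPart hI.sq_le hI.le_lineIdeal).1 hf
    have h2 := sub_restr_sub_lin_mem f
    rw [h0, map_zero, sub_zero] at h2
    rw [← hbsp, Submodule.mem_span_range_iff_exists_fun] at h1
    obtain ⟨c, hc⟩ := h1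
    have h3 : xdot K n (fun j => lin j f) ∈
        Ideal.span (Set.range fun l => xdot K n (b l)) := by
      rw [← hc, map_sum]
      refine Ideal.sum_mem _ fun l _ => ?_
      rw [xdot_smul]
      exact Ideal.mul_mem_left _ _ (Ideal.subset_span ⟨l, rfl⟩)
    have h4 := Submodule.add_mem_sup h2 h3
    rwa [sub_add_cancel] at h4
  · refine sup_le hI.sq_le ?_
    rw [Ideal.span_le]
    rintro _ ⟨l, rfl⟩
    have : b l ∈ linearPart I := by
      rw [← hbsp]
      exact Submodule.subset_span ⟨l, rfl⟩
    exact this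

/-- The linear part of a rope is the kernel of any matrix `A` associated to it. -/
theorem IsAssociated.mulVec_eq_zero_iff {k : ℕ} {I : Ideal (R K n)} {α : Fin (n - 1 - k) → ℕ}
    {β : Fin k → ℕ} {A : Matrix (Fin (n - 1 - k)) (Fin (n - 1)) (S K)}
    {B : Matrix (Fin (n - 1)) (Fin k) (S K)} (h : IsAssociated I α β A B) (hn : 2 ≤ n)
    (hk : k < n) (hI : IsRope I (n - k)) (v : Fin (n - 1) → S K) :
    A.mulVec v = 0 ↔ v ∈ linearPart I := by
  have hinj := algebraMap_localization_injective (lpt (genericLine K))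
  -- The given data are exact on stalks only. The auxiliary `A'` exhibits the linear part as a
  -- kernel, so nonzero factors can be cancelled.
  obtain ⟨_, _, A', _, -, hA'⟩ := hI.exists_isAssociated hn hk
  have hcol : ∀ l, xdot K n (fun j => B j l) = ∑ j, x K j * incl K n (B j l) := fun l => rfl
  have hBN : ∀ c, B.mulVec c ∈ linearPart I := by
    intro c
    have : B.mulVec c = ∑ l, c l • fun j => B j l := by
      ext1 j
      simp [Matrix.mulVec, dotProduct, mul_comm]
    rw [this]
    refine Submodule.sum_mem _ fun l _ => Submodule.smul_mem _ _ ?_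
    rw [mem_linearPart, hcol, h.ideal_eq]
    exact Ideal.mem_sup_right (Ideal.subset_span ⟨l, rfl⟩)
  constructor
  · intro hv
    have h1 := (h.exact (genericLine K) (fun j => algebraMap _ _ (v j))).1 (by
      ext1 i
      rw [map_mulVec_algebraMap, hv]
      simp)
    obtain ⟨c, hc⟩ := h1
    obtain ⟨s, hs, w, hw⟩ := exists_clear_denominators (lpt (genericLine K)).primeCompl c
    have h2 : s • v = B.mulVec w := by
      ext1 j
      apply hinj
      rw [← map_mulVec_algebraMap, ← funext hw, smul_mulVec_eq, hc, Pi.smul_apply, smul_eq_mul,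
        map_mul]
    have h3 : A'.mulVec (s • v) = 0 := by
      rw [hA', h2]
      exact hBN w
    rw [Matrix.mulVec_smul] at h3
    rw [← hA']
    refine (smul_eq_zero.1 h3).resolve_left ?_
    rintro rfl
    exact hs (Ideal.zero_mem _)
  · intro hv
    have hAB : A * B = 0 := by
      refine Matrix.ext fun i l => ?_
      apply hinj
      have h1 := congrFun ((h.exact (genericLine K) _).2 ⟨Pi.single l 1, rfl⟩) i
      rw [Matrix.mulVec_mulVec, ← Matrix.map_mul, Matrix.mulVec_single_one] at h1
      rw [Matrix.zero_apply, map_zero]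
      exact h1
    -- The generators of `I` are tested in one ideal. The condition `restr f = 0` makes it closed
    -- under multiplication, as `lin j` is only a derivation along `restr`.
    have hle : I ≤ {
        carrier := {f : R K n | A.mulVec (fun j => lin j f) = 0 ∧ restr K n f = 0}
        zero_mem' := ⟨by simp only [map_zero]; exact A.mulVec_zero, map_zero _⟩
        add_mem' := fun {f g} hf hg => ⟨by
          have : (fun j => lin j (f + g)) = (fun j => lin j f) + fun j => lin j g := by
            ext1 j; simp
          rw [this, Matrix.mulVec_add, hf.1, hg.1, add_zero], by rw [map_add, hf.2, hg.2, add_zero]⟩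
        smul_mem' := fun c f hf => ⟨by
          have : (fun j => lin j (c • f)) = restr K n c • fun j => lin j f := by
            ext1 j; simp [lin_mul, hf.2]
          rw [this, Matrix.mulVec_smul, hf.1, smul_zero], by simp [hf.2]⟩ : Ideal (R K n)} := by
      rw [h.ideal_eq]
      refine sup_le ?_ ?_
      · intro f hf
        refine ⟨?_, mem_lineIdeal_iff.1 (Ideal.pow_le_self two_ne_zero hf)⟩
        simp only [lin_eq_zero_of_mem_sq hf]
        exact A.mulVec_zero
      · rw [Ideal.span_le]
        rintro _ ⟨l, rfl⟩
        dsimp only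
        rw [← hcol]
        refine ⟨?_, restr_xdot _⟩
        simp only [lin_xdot]
        ext1 i
        have := congrFun (congrFun hAB i) l
        simpa [Matrix.mul_apply, Matrix.mulVec, dotProduct] using this
    have := (hle hv).1
    simpa only [lin_xdot] using this

/-! ### Homogeneous polynomials of integral degree -/

/-- Monomial by monomial, the condition is visibly additive and needs no case for negative `e`. -/
theorem mem_SDeg_iff {e : ℤ} {f : S K} :
    f ∈ SDeg K e ↔ ∀ m ∈ f.support, (m.degree : ℤ) = e := by
  constructor
  · rintro (rfl | ⟨d, rfl, hf⟩) m hm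
    · simp at hm
    · by_contra hne
      exact (mem_support_iff.1 hm) (hf.coeff_eq_zero (by exact_mod_cast hne))
  · intro h
    by_cases hf : f = 0
    · exact Or.inl hf
    · obtain ⟨m, hm⟩ := support_nonempty.2 hf
      refine Or.inr ⟨m.degree, h m hm, fun m' hm' => ?_⟩
      have h1 := h m' (mem_support_iff.2 hm')
      rw [← h m hm] at h1
      change Finsupp.weight (fun _ => 1) m' = _
      rw [← Finsupp.degree_eq_weight_one]
      exact_mod_cast h1

theorem SDeg_of_isHomogeneous {f : S K} {d : ℕ} (hf : f.IsHomogeneous d) : f ∈ SDeg K d :=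
  Or.inr ⟨d, rfl, hf⟩

theorem zero_mem_SDeg (e : ℤ) : (0 : S K) ∈ SDeg K e := Or.inl rfl

theorem add_mem_SDeg {e : ℤ} {f g : S K} (hf : f ∈ SDeg K e) (hg : g ∈ SDeg K e) :
    f + g ∈ SDeg K e := by
  classical
  rw [mem_SDeg_iff] at *
  intro m hm
  rcases Finset.mem_union.1 (support_add hm) with h | h
  · exact hf m h
  · exact hg m h

theorem neg_mem_SDeg {e : ℤ} {f : S K} (hf : f ∈ SDeg K e) : -f ∈ SDeg K e := by
  rw [mem_SDeg_iff] at *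
  intro m hm
  rw [support_neg] at hm
  exact hf m hm

theorem sum_mem_SDeg {ι : Type*} {s : Finset ι} {e : ℤ} {f : ι → S K}
    (hf : ∀ i ∈ s, f i ∈ SDeg K e) : ∑ i ∈ s, f i ∈ SDeg K e :=
  Finset.sum_induction f (· ∈ SDeg K e) (fun _ _ => add_mem_SDeg) (zero_mem_SDeg e) hf

theorem mul_mem_SDeg {e e' : ℤ} {f g : S K} (hf : f ∈ SDeg K e) (hg : g ∈ SDeg K e') :
    f * g ∈ SDeg K (e + e') := by
  rcases hf with rfl | ⟨d, rfl, hf⟩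
  · rw [zero_mul]; exact zero_mem_SDeg _
  rcases hg with rfl | ⟨d', rfl, hg⟩
  · rw [mul_zero]; exact zero_mem_SDeg _
  exact Or.inr ⟨d + d', by push_cast; rfl, hf.mul hg⟩

theorem mem_SDeg_of_mul {e : ℤ} {j : ℕ} {f g : S K} (hg : g.IsHomogeneous j) (hg0 : g ≠ 0)
    (h : f * g ∈ SDeg K (e + j)) : f ∈ SDeg K e := by
  rcases h with h | ⟨d, hd, h⟩
  · exact Or.inl ((mul_eq_zero.1 h).resolve_right hg0)
  · rcases Nat.lt_or_ge d j with hlt | hge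
    · exact Or.inl (eq_zero_of_mul_isHomogeneous hg hg0 hlt h)
    · refine Or.inr ⟨d - j, by omega, isHomogeneous_of_mul hg hg0 ?_⟩
      rwa [Nat.sub_add_cancel hge]

theorem lin_mem_SDeg {f : R K n} {d : ℕ} (hf : f.IsHomogeneous d) (j : Fin (n - 1)) :
    lin j f ∈ SDeg K (d - 1 : ℤ) := by
  rcases d with _ | d
  · rw [lin_isHomogeneous_zero hf]
    exact zero_mem_SDeg _
  · exact Or.inr ⟨d, by push_cast; ring, lin_isHomogeneous hf j⟩

/-- The `b` with `b₀ ∣ b * c₀` form a homogeneous ideal without zeros on the line, so it contains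
powers of both variables. These are coprime, hence `b₀ ∣ c₀`. -/
theorem dvd_of_forall_point {b₀ c₀ : S K} {j : ℕ} {e : ℤ} (hb₀ : b₀.IsHomogeneous j)
    (h0 : b₀ ≠ 0) (hc₀ : c₀ ∈ SDeg K e)
    (h : ∀ q : ProjectiveSpectrum (homogeneousSubmodule (Fin 2) K), ∃ b ∉ lpt q, b₀ ∣ b * c₀) :
    b₀ ∣ c₀ := by
  rcases hc₀ with rfl | ⟨d, -, hc₀⟩
  · exact dvd_zero _
  let J : Ideal (S K) := Submodule.comap (LinearMap.mulRight (S K) c₀) (Ideal.span {b₀})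
  have hJ : ∀ b, b ∈ J ↔ b₀ ∣ b * c₀ := fun b => Ideal.mem_span_singleton
  have hX := exists_X_pow_mem (J := J)
    (fun f hf e => by
      rw [hJ] at hf ⊢
      obtain ⟨w, hw⟩ := hf
      rw [← homogeneousComponent_mul_of_isHomogeneous hc₀, hw, mul_comm]
      rcases Nat.lt_or_ge (e + d) j with hlt | hge
      · rw [homogeneousComponent_mul_of_lt hb₀ hlt]
        exact dvd_zero _
      · obtain ⟨p, hp⟩ := Nat.exists_eq_add_of_le' hge
        rw [hp, homogeneousComponent_mul_of_isHomogeneous hb₀]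
        exact Dvd.intro_left _ rfl)
    (fun q => by
      obtain ⟨b, hb, hd⟩ := h q
      exact ⟨b, (hJ b).2 hd, hb⟩)
  obtain ⟨N, hN⟩ := hX 0
  obtain ⟨M, hM⟩ := hX 1
  rw [hJ] at hN hM
  obtain ⟨u, hu⟩ := hN
  obtain ⟨w, hw⟩ := hM
  have h1 : X 1 ^ M * u = X 0 ^ N * w := by
    apply mul_left_cancel₀ h0
    linear_combination X 0 ^ N * hw - X 1 ^ M * hu
  have hprime : Prime (X 0 : S K) := X_prime
  have hnd : ¬ (X 0 : S K) ∣ X 1 ^ M := fun hd => by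
    have := hprime.dvd_of_dvd_pow hd
    rw [X_dvd_X] at this
    exact zero_ne_one this
  obtain ⟨u', hu'⟩ : X 0 ^ N ∣ u := hprime.pow_dvd_of_dvd_mul_left N hnd ⟨w, h1⟩
  refine ⟨u', mul_left_cancel₀ (pow_ne_zero N (X_ne_zero (0 : Fin 2))) ?_⟩
  rw [hu, hu']
  ring

/-- A rational function that is regular at all points of the line, in degree `e`, is a homogeneous
polynomial of degree `e`. -/
theorem exists_eq_algebraMap_of_forall_point {F : Type*} [Field F] [Algebra (S K) F]
    [IsFractionRing (S K) F] {y : F} {e : ℤ}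
    (h : ∀ q : ProjectiveSpectrum (homogeneousSubmodule (Fin 2) K), ∃ (j : ℕ) (b c : S K),
      b ∉ lpt q ∧ b.IsHomogeneous j ∧ c ∈ SDeg K (e + j) ∧
        y * algebraMap _ _ b = algebraMap _ _ c) :
    ∃ f ∈ SDeg K e, y = algebraMap _ _ f := by
  have hinj := IsFractionRing.injective (S K) F
  -- The fraction at the generic point serves as the global one; comparing with `c / b` at `q` gives
  -- `b * c₀ = b₀ * c`.
  obtain ⟨j, b₀, c₀, hb₀, hbj, hc₀, hy⟩ := h (genericLine K)
  have h0 : b₀ ≠ 0 := by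
    rintro rfl
    exact hb₀ (Ideal.zero_mem _)
  obtain ⟨f, hf⟩ := dvd_of_forall_point hbj h0 hc₀ fun q => by
    obtain ⟨_, b, c, hb, -, -, hyc⟩ := h q
    refine ⟨b, hb, c, hinj ?_⟩
    rw [map_mul, map_mul, ← hy, ← hyc]
    ring
  have hb0 : algebraMap (S K) F b₀ ≠ 0 := fun h =>
    h0 ((map_eq_zero_iff _ hinj).1 h)
  refine ⟨f, mem_SDeg_of_mul hbj h0 (by rwa [mul_comm, ← hf]), mul_right_cancel₀ hb0 ?_⟩
  rw [hy, hf, map_mul, mul_comm]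

theorem det_isHomogeneous {a : ℕ} {M : Matrix (Fin a) (Fin a) (S K)} {γ : Fin a → ℕ}
    (h : ∀ i j, (M i j).IsHomogeneous (γ i)) : M.det.IsHomogeneous (∑ i, γ i) := by
  rw [Matrix.det_apply]
  refine IsHomogeneous.sum _ _ _ fun σ _ => ?_
  have h1 : (∏ i, M (σ i) i).IsHomogeneous (∑ i, γ i) := by
    rw [← Equiv.sum_comp σ γ]
    exact IsHomogeneous.prod _ _ _ fun i _ => h _ _
  rcases Int.units_eq_one_or (Equiv.Perm.sign σ) with hs | hs
  · rwa [hs, one_smul]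
  · rw [hs, Units.neg_smul, one_smul]
    exact h1.neg

/-- The entry is the determinant of `M` with row `i` replaced by a unit vector, so that row
contributes degree `0` instead of `γ i`. -/
theorem adjugate_isHomogeneous {a : ℕ} {M : Matrix (Fin a) (Fin a) (S K)} {γ : Fin a → ℕ}
    (h : ∀ i j, (M i j).IsHomogeneous (γ i)) (c i : Fin a) :
    (M.adjugate c i).IsHomogeneous (∑ i', Function.update γ i 0 i') := by
  rw [Matrix.adjugate_apply]
  apply det_isHomogeneous
  intro i' j
  by_cases hi : i' = i
  · subst hi
    rw [Matrix.updateRow_self, Function.update_self, Pi.single_apply]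
    split_ifs
    · exact isHomogeneous_one _ _
    · exact isHomogeneous_zero _ _ _
  · rw [Matrix.updateRow_ne hi, Function.update_of_ne hi]
    exact h i' j

/-! ### Germs -/

theorem subsingleton_germ {I : Ideal (R K n)} {p : Pn K n} {f : R K n} (hf : f ∈ I)
    (hfp : f ∉ pt p) : Subsingleton (Germ I p) := by
  apply subsingleton_of_zero_eq_one
  have hu := isUnit_algebraMap I p f hfp
  have h0 : algebraMap (R K n) (Germ I p) f = 0 :=
    Ideal.Quotient.eq_zero_iff_mem.2 (Ideal.mem_map_of_mem _ hf)
  rw [h0] at hu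
  exact isUnit_zero_iff.1 hu

theorem algebraMap_germ_of_mem {I : Ideal (R K n)} (p : Pn K n) {f : R K n} (hf : f ∈ I) :
    algebraMap (R K n) (Germ I p) f = 0 :=
  Ideal.Quotient.eq_zero_iff_mem.2 (Ideal.mem_map_of_mem _ hf)

theorem algebraMap_incl (I : Ideal (R K n)) (p : Pn K n) (f : S K) :
    algebraMap (R K n) (Germ I p) (incl K n f) = algebraMap (S K) (Germ I p) f := rfl

/-- Open sets are stable under generization. Any neighbourhood of a point of `L` thus contains the
generic point of `L`. -/
theorem mem_of_le {p p' : Pn K n} (h : pt p' ≤ pt p) {V : Set (Pn K n)} (hV : IsOpen V)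
    (hp : p ∈ V) : p' ∈ V := by
  have h1 : p ∈ closure ({p'} : Set (Pn K n)) :=
    (ProjectiveSpectrum.le_iff_mem_closure _ p' p).1 h
  obtain ⟨x, hx, hx'⟩ := mem_closure_iff.1 h1 V hV hp
  rwa [← Set.mem_singleton_iff.1 hx']

/-- The generic point of the line, in projective space. -/
def genericPoint (K : Type*) [Field K] (n : ℕ) : Pn K n := linePoint n (genericLine K)

theorem mem_genericPoint {f : R K n} : f ∈ pt (genericPoint K n) ↔ restr K n f = 0 := Iff.rfl

theorem genericPoint_le (q : ProjectiveSpectrum (homogeneousSubmodule (Fin 2) K)) :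
    pt (genericPoint K n) ≤ pt (linePoint n q) := fun f hf => by
  rw [mem_linePoint, mem_genericPoint.1 hf]
  exact Ideal.zero_mem _

/-! ### The first order expansion at the generic point of the line -/

/-- The ring `F ⊕ F ^ a` where `F` is the field of fractions of `S`. -/
abbrev GenericRing (F : Type*) (a : ℕ) := TrivSqZeroExt F (Fin a → F)

variable (F : Type*) [Field F] [Algebra (S K) F] {a : ℕ}

/-- The coefficients of the linear part of `f` in the coordinates `z_i` with `x_j = ∑ z_i A i j`. -/
def linVec (A : Matrix (Fin a) (Fin (n - 1)) (S K)) (f : R K n) : Fin a → S K :=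
  A.mulVec fun j => lin j f

theorem linVec_add (A : Matrix (Fin a) (Fin (n - 1)) (S K)) (f g : R K n) :
    linVec A (f + g) = linVec A f + linVec A g := by
  have h : (fun j => lin j (f + g)) = (fun j => lin j f) + fun j => lin j g :=
    by funext j; rw [Pi.add_apply, map_add]
  rw [linVec, h, Matrix.mulVec_add]
  rfl

theorem linVec_mul (A : Matrix (Fin a) (Fin (n - 1)) (S K)) (f g : R K n) :
    linVec A (f * g) = restr K n f • linVec A g + restr K n g • linVec A f := by
  have h : (fun j => lin j (f * g)) =
      restr K n f • (fun j => lin j g) + restr K n g • fun j => lin j f :=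
    by funext j; rw [Pi.add_apply, Pi.smul_apply, Pi.smul_apply, lin_mul, smul_eq_mul, smul_eq_mul]
  rw [linVec, h, Matrix.mulVec_add, Matrix.mulVec_smul, Matrix.mulVec_smul]
  rfl

theorem linVec_incl (A : Matrix (Fin a) (Fin (n - 1)) (S K)) (f : S K) :
    linVec A (incl K n f) = 0 := by
  change A.mulVec (fun j => lin j (incl K n f)) = 0
  simp only [lin_incl]
  exact A.mulVec_zero

theorem linVec_apply (A : Matrix (Fin a) (Fin (n - 1)) (S K)) (f : R K n) :
    linVec A f = A.mulVec fun j => lin j f := rfl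

/-- The first order expansion in the coordinates `z_i` with `x_j = ∑ z_i A i j`, as a function. -/
def expansionFun (A : Matrix (Fin a) (Fin (n - 1)) (S K)) (f : R K n) : GenericRing F a :=
  TrivSqZeroExt.inl (algebraMap (S K) F (restr K n f)) +
    TrivSqZeroExt.inr fun i => algebraMap (S K) F (linVec A f i)

theorem fst_expansionFun (A : Matrix (Fin a) (Fin (n - 1)) (S K)) (f : R K n) :
    (expansionFun F A f).fst = algebraMap (S K) F (restr K n f) := by
  rw [expansionFun, TrivSqZeroExt.fst_add, TrivSqZeroExt.fst_inl, TrivSqZeroExt.fst_inr, add_zero]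

theorem snd_expansionFun (A : Matrix (Fin a) (Fin (n - 1)) (S K)) (f : R K n) :
    (expansionFun F A f).snd = fun i => algebraMap (S K) F (linVec A f i) := by
  rw [expansionFun, TrivSqZeroExt.snd_add, TrivSqZeroExt.snd_inl, TrivSqZeroExt.snd_inr, zero_add]

theorem expansionFun_mul (A : Matrix (Fin a) (Fin (n - 1)) (S K)) (f g : R K n) :
    expansionFun F A (f * g) = expansionFun F A f * expansionFun F A g := by
  refine TrivSqZeroExt.ext ?_ (funext fun i => ?_)
  · rw [TrivSqZeroExt.fst_mul, fst_expansionFun, fst_expansionFun, fst_expansionFun, map_mul,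
      map_mul]
  · rw [TrivSqZeroExt.snd_mul, fst_expansionFun, fst_expansionFun, snd_expansionFun,
      snd_expansionFun, snd_expansionFun, linVec_mul, op_smul_eq_smul]
    change algebraMap (S K) F (restr K n f * linVec A g i + restr K n g * linVec A f i) =
      algebraMap (S K) F (restr K n f) * algebraMap (S K) F (linVec A g i) +
        algebraMap (S K) F (restr K n g) * algebraMap (S K) F (linVec A f i)
    rw [map_add, map_mul, map_mul]

/-- The first order expansion in the coordinates `z_i` with `x_j = ∑ z_i A i j`. -/
def genericExpansion (A : Matrix (Fin a) (Fin (n - 1)) (S K)) : R K n →+* GenericRing F a where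
  toFun := expansionFun F A
  map_one' := by
    refine TrivSqZeroExt.ext ?_ ?_
    · rw [fst_expansionFun, map_one, map_one, TrivSqZeroExt.fst_one]
    · rw [snd_expansionFun, ← map_one (incl K n), linVec_incl, TrivSqZeroExt.snd_one]
      exact funext fun i => map_zero _
  map_mul' := expansionFun_mul F A
  map_zero' := by
    refine TrivSqZeroExt.ext ?_ ?_
    · rw [fst_expansionFun, map_zero, map_zero, TrivSqZeroExt.fst_zero]
    · rw [snd_expansionFun, ← map_zero (incl K n), linVec_incl, TrivSqZeroExt.snd_zero]
      exact funext fun i => map_zero _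
  map_add' f g := by
    refine TrivSqZeroExt.ext ?_ ?_
    · rw [TrivSqZeroExt.fst_add, fst_expansionFun, fst_expansionFun, fst_expansionFun, map_add,
        map_add]
    · rw [TrivSqZeroExt.snd_add, snd_expansionFun, snd_expansionFun, snd_expansionFun, linVec_add]
      exact funext fun i => map_add _ _ _

theorem fst_genericExpansion (A : Matrix (Fin a) (Fin (n - 1)) (S K)) (f : R K n) :
    (genericExpansion F A f).fst = algebraMap _ _ (restr K n f) :=
  fst_expansionFun F A f

theorem snd_genericExpansion (A : Matrix (Fin a) (Fin (n - 1)) (S K)) (f : R K n) (i : Fin a) :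
    (genericExpansion F A f).snd i = algebraMap _ _ (linVec A f i) :=
  congrFun (snd_expansionFun F A f) i

theorem genericExpansion_incl (A : Matrix (Fin a) (Fin (n - 1)) (S K)) (f : S K) :
    genericExpansion F A (incl K n f) = algebraMap (S K) (GenericRing F a) f := by
  refine TrivSqZeroExt.ext ?_ (funext fun i => ?_)
  · rw [fst_genericExpansion, restr_incl]
    rfl
  · rw [snd_genericExpansion]
    rw [linVec_incl]
    simp [TrivSqZeroExt.algebraMap_eq_inl']

/-- The kernel of the expansion is the ideal of a rope with matrix `A`. -/
theorem genericExpansion_eq_zero_iff [IsFractionRing (S K) F] {I : Ideal (R K n)} (h2 : lineIdeal K n ^ 2 ≤ I)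
    (h1 : I ≤ lineIdeal K n) {A : Matrix (Fin a) (Fin (n - 1)) (S K)}
    (hA : ∀ v, A.mulVec v = 0 ↔ v ∈ linearPart I) {f : R K n} :
    genericExpansion F A f = 0 ↔ f ∈ I := by
  have hinj := IsFractionRing.injective (S K) F
  rw [mem_iff_linearPart h2 h1, ← hA, ← linVec_apply]
  constructor
  · intro h
    constructor
    · have := congrArg TrivSqZeroExt.fst h
      rw [fst_genericExpansion] at this
      exact (map_eq_zero_iff _ hinj).1 this
    · ext1 i
      have := congrFun (congrArg TrivSqZeroExt.snd h) i
      rw [snd_genericExpansion] at this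
      exact (map_eq_zero_iff _ hinj).1 this
  · rintro ⟨h3, h4⟩
    refine TrivSqZeroExt.ext ?_ (funext fun i => ?_)
    · rw [fst_genericExpansion, h3, map_zero]
      rfl
    · rw [snd_genericExpansion, h4, Pi.zero_apply, map_zero]
      rfl

/-- The second summand squares to zero, so invertibility is decided on `F`. This lets the expansion
extend to germs at the generic point. -/
theorem isUnit_genericExpansion [IsFractionRing (S K) F] (A : Matrix (Fin a) (Fin (n - 1)) (S K)) {f : R K n}
    (hf : restr K n f ≠ 0) : IsUnit (genericExpansion F A f) := by
  rw [TrivSqZeroExt.isUnit_iff_isUnit_fst, fst_genericExpansion, isUnit_iff_ne_zero]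
  exact fun h => hf ((map_eq_zero_iff _ (IsFractionRing.injective (S K) F)).1 h)

/-- The expansion of germs at the generic point of the line. -/
def germExpansion [IsFractionRing (S K) F] {I : Ideal (R K n)} (A : Matrix (Fin a) (Fin (n - 1)) (S K))
    (hI : ∀ f ∈ I, genericExpansion F A f = 0) : Germ I (genericPoint K n) →+* GenericRing F a :=
  Ideal.Quotient.lift _
    (IsLocalization.lift (M := (pt (genericPoint K n)).primeCompl)
      (S := Localization.AtPrime (pt (genericPoint K n))) (g := genericExpansion F A)
      fun f => isUnit_genericExpansion F A fun h => f.2 h)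
    (by
      intro f hf
      have : I.map (algebraMap (R K n) (Localization.AtPrime (pt (genericPoint K n)))) ≤
          RingHom.ker (IsLocalization.lift (M := (pt (genericPoint K n)).primeCompl)
            (S := Localization.AtPrime (pt (genericPoint K n))) (g := genericExpansion F A)
            fun f => isUnit_genericExpansion F A fun h => f.2 h) := by
        rw [Ideal.map_le_iff_le_comap]
        intro g hg
        rw [Ideal.mem_comap, RingHom.mem_ker, IsLocalization.lift_eq]
        exact hI g hg
      exact this hf)

theorem germExpansion_algebraMap [IsFractionRing (S K) F] {I : Ideal (R K n)} (A : Matrix (Fin a) (Fin (n - 1)) (S K))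
    (hI : ∀ f ∈ I, genericExpansion F A f = 0) (f : R K n) :
    germExpansion F A hI (algebraMap (R K n) (Germ I (genericPoint K n)) f) = genericExpansion F A f :=
  IsLocalization.lift_eq _ _

theorem germExpansion_smul [IsFractionRing (S K) F] {I : Ideal (R K n)} (A : Matrix (Fin a) (Fin (n - 1)) (S K))
    (hI : ∀ f ∈ I, genericExpansion F A f = 0) (f : S K) (s : Germ I (genericPoint K n)) :
    germExpansion F A hI (f • s) = f • germExpansion F A hI s := by
  rw [Algebra.smul_def, map_mul, ← algebraMap_incl, germExpansion_algebraMap,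
    genericExpansion_incl, Algebra.smul_def]

/-! ### Sections are determined by their germ at the generic point -/

/-- Near a point of the line, a section is a fraction, also at the generic point. -/
theorem IsSection.exists_frac {I : Ideal (R K n)} {d : ℤ} {s : ∀ p : Pn K n, Germ I p}
    (hs : IsSection I d s) (q : ProjectiveSpectrum (homogeneousSubmodule (Fin 2) K)) :
    ∃ (i j : ℕ) (f g : R K n), f.IsHomogeneous i ∧ g.IsHomogeneous j ∧ (i : ℤ) - j = d ∧
      restr K n g ∉ lpt q ∧
      s (linePoint n q) * algebraMap (R K n) _ g = algebraMap (R K n) _ f ∧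
      s (genericPoint K n) * algebraMap (R K n) _ g = algebraMap (R K n) _ f := by
  obtain ⟨V, hV, hp, i, j, f, g, hf, hg, hd, h⟩ := hs (linePoint n q)
  obtain ⟨h1, e1⟩ := h _ hp
  obtain ⟨h2, e2⟩ := h _ (mem_of_le (genericPoint_le q) hV hp)
  rw [eq_frac_iff] at e1 e2
  exact ⟨i, j, f, g, hf, hg, hd, h1, e1, e2⟩

/-- Near a point of `L` the section is one fraction `f / g`, also valid at the generic point. There
its vanishing puts `f` in the kernel of the expansion, which is `I`, so the germ is zero. Off `C`
the germ rings are trivial. -/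
theorem section_eq_zero [IsFractionRing (S K) F] {I : Ideal (R K n)} {A : Matrix (Fin a) (Fin (n - 1)) (S K)}
    (hA : ∀ f, genericExpansion F A f = 0 ↔ f ∈ I) (hsupp : ∀ p : Pn K n, I ≤ pt p →
      lineIdeal K n ≤ pt p) {d : ℤ} {s : ∀ p : Pn K n, Germ I p} (hs : IsSection I d s)
    (h0 : germExpansion F A (fun f hf => (hA f).2 hf) (s (genericPoint K n)) = 0) : s = 0 := by
  ext1 p
  by_cases hp : I ≤ pt p
  · obtain ⟨q, rfl⟩ := exists_eq_linePoint (hsupp p hp)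
    obtain ⟨i, j, f, g, -, -, -, hg, e1, e2⟩ := hs.exists_frac q
    have h1 := congrArg (germExpansion F A (fun f hf => (hA f).2 hf)) e2
    rw [map_mul, h0, zero_mul, germExpansion_algebraMap, eq_comm, hA] at h1
    rw [algebraMap_germ_of_mem _ h1] at e1
    exact (isUnit_algebraMap I _ g hg).mul_left_eq_zero.1 e1
  · obtain ⟨f, hf, hfp⟩ := Set.not_subset.1 hp
    have := subsingleton_germ hf hfp
    exact Subsingleton.elim _ _

/-- The expansion of a section at the generic point has polynomial coefficients. -/
theorem exists_coefficients [IsFractionRing (S K) F] {I : Ideal (R K n)} {A : Matrix (Fin a) (Fin (n - 1)) (S K)}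
    (hA : ∀ f, genericExpansion F A f = 0 ↔ f ∈ I) {α : Fin a → ℕ}
    (hα : ∀ i j, (A i j).IsHomogeneous (α i))
    {d : ℤ} {s : ∀ p : Pn K n, Germ I p} (hs : IsSection I d s) :
    ∃ (P : S K) (Q : Fin a → S K), P ∈ SDeg K d ∧ (∀ i, Q i ∈ SDeg K (d + α i - 1)) ∧
      germExpansion F A (fun f hf => (hA f).2 hf) (s (genericPoint K n)) =
        TrivSqZeroExt.inl (algebraMap _ _ P) + TrivSqZeroExt.inr fun i => algebraMap _ _ (Q i) := by
  set y := germExpansion F A (fun f hf => (hA f).2 hf) (s (genericPoint K n)) with hy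
  have key : ∀ q : ProjectiveSpectrum (homogeneousSubmodule (Fin 2) K),
      ∃ (i j : ℕ) (f g : R K n), f.IsHomogeneous i ∧ g.IsHomogeneous j ∧ (i : ℤ) - j = d ∧
      restr K n g ∉ lpt q ∧ y * genericExpansion F A g = genericExpansion F A f := fun q => by
    obtain ⟨i, j, f, g, hf, hg, hd, hgq, -, e2⟩ := hs.exists_frac q
    refine ⟨i, j, f, g, hf, hg, hd, hgq, ?_⟩
    rw [hy, ← germExpansion_algebraMap F A (fun f hf => (hA f).2 hf), ← map_mul, e2,
      germExpansion_algebraMap]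
  have hfst : ∀ (f g : R K n), y * genericExpansion F A g = genericExpansion F A f →
      y.fst * algebraMap _ _ (restr K n g) = algebraMap _ _ (restr K n f) := fun f g h => by
    have := congrArg TrivSqZeroExt.fst h
    rwa [TrivSqZeroExt.fst_mul, fst_genericExpansion, fst_genericExpansion] at this
  have hlin : ∀ (f : R K n) (i : ℕ) (l : Fin a), f.IsHomogeneous i →
      linVec A f l ∈ SDeg K (α l + (i - 1)) := fun f i l hf => by
    change ∑ j, A l j * lin j f ∈ _
    exact sum_mem_SDeg fun j _ => mul_mem_SDeg (SDeg_of_isHomogeneous (hα l j)) (lin_mem_SDeg hf j)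
  obtain ⟨P, hP, hyP⟩ := exists_eq_algebraMap_of_forall_point (F := F) (y := y.fst) (e := d) fun q => by
    obtain ⟨i, j, f, g, hf, hg, hd, hgq, e⟩ := key q
    refine ⟨j, _, restr K n f, hgq, restr_isHomogeneous hg, ?_, hfst f g e⟩
    rw [← hd, sub_add_cancel]
    exact SDeg_of_isHomogeneous (restr_isHomogeneous hf)
  have hQ : ∀ l, ∃ Q ∈ SDeg K (d + α l - 1), y.snd l = algebraMap _ _ Q := fun l => by
    refine exists_eq_algebraMap_of_forall_point fun q => ?_
    obtain ⟨i, j, f, g, hf, hg, hd, hgq, e⟩ := key q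
    -- The second component of `y * g = f` reads `y₁ g|_L + y₀ lin(g) = lin(f)`. With `y₀ = P`
    -- already a polynomial, this presents `y₁` with denominator `g|_L`.
    refine ⟨j, _, linVec A f l - P * linVec A g l, hgq,
      restr_isHomogeneous hg, ?_, ?_⟩
    · rw [sub_eq_add_neg (linVec A f l)]
      refine add_mem_SDeg ?_ (neg_mem_SDeg ?_)
      · convert hlin f i l hf using 1
        rw [← hd]
        ring_nf
      · convert mul_mem_SDeg hP (hlin g j l hg) using 1
        ring_nf
    · have h1 := congrFun (congrArg TrivSqZeroExt.snd e) l
      rw [TrivSqZeroExt.snd_mul, Pi.add_apply, Pi.smul_apply, Pi.smul_apply,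
        fst_genericExpansion, snd_genericExpansion, snd_genericExpansion, op_smul_eq_smul,
        smul_eq_mul, smul_eq_mul, hyP] at h1
      rw [map_sub, map_mul, ← h1]
      ring
  choose Q hQd hQe using hQ
  refine ⟨P, Q, hP, hQd, ?_⟩
  refine TrivSqZeroExt.ext ?_ (funext fun l => ?_)
  · simp [hyP]
  · simp [hQe]

/-! ### The sections `z_i` -/

theorem mem_U_linePoint {A : Matrix (Fin a) (Fin (n - 1)) (S K)} {J : Fin a ↪o Fin (n - 1)}
    {q : ProjectiveSpectrum (homogeneousSubmodule (Fin 2) K)} :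
    linePoint n q ∈ U A J ↔ (A.submatrix id J).det ∉ lpt q := by
  change incl K n _ ∉ pt _ ↔ _
  rw [mem_linePoint, restr_incl]

theorem isUnit_det_map {I : Ideal (R K n)} {A : Matrix (Fin a) (Fin (n - 1)) (S K)}
    {J : Fin a ↪o Fin (n - 1)} {p : Pn K n} (hp : p ∈ U A J) :
    IsUnit ((A.submatrix id J).map (algebraMap (S K) (Germ I p))).det := by
  rw [← RingHom.mapMatrix_apply, ← RingHom.map_det, ← algebraMap_incl]
  exact isUnit_algebraMap I p _ hp

theorem zLocal_mul_det {I : Ideal (R K n)} {A : Matrix (Fin a) (Fin (n - 1)) (S K)}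
    {J : Fin a ↪o Fin (n - 1)} {p : Pn K n} (hp : p ∈ U A J) (i : Fin a) :
    zLocal I A J p i * algebraMap (S K) (Germ I p) (A.submatrix id J).det =
      ∑ c, algebraMap (R K n) (Germ I p) (x K (J c)) *
        algebraMap (S K) (Germ I p) ((A.submatrix id J).adjugate c i) := by
  have hd : ((A.submatrix id J).map (algebraMap (S K) (Germ I p))).det =
      algebraMap (S K) (Germ I p) (A.submatrix id J).det := by
    rw [← RingHom.mapMatrix_apply, ← RingHom.map_det]
  have hu := isUnit_det_map (I := I) hp
  rw [zLocal, Matrix.inv_def, Matrix.vecMul_smul, Pi.smul_apply, smul_eq_mul, ← hd,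
    mul_right_comm, Ring.inverse_mul_cancel _ hu, one_mul, ← RingHom.mapMatrix_apply,
    ← RingHom.map_adjugate]
  rfl

/-- On `U_J`, `x = z A`. -/
theorem vecMul_zLocal {I : Ideal (R K n)} {A : Matrix (Fin a) (Fin (n - 1)) (S K)}
    (hA : ∀ v, A.mulVec v = 0 → v ∈ linearPart I) {J : Fin a ↪o Fin (n - 1)} {p : Pn K n}
    (hp : p ∈ U A J) (j : Fin (n - 1)) :
    ∑ i, zLocal I A J p i * algebraMap (S K) (Germ I p) (A i j) =
      algebraMap (R K n) (Germ I p) (x K j) := by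
  have hu : IsUnit (algebraMap (S K) (Germ I p) (A.submatrix id J).det) := by
    rw [← algebraMap_incl]
    exact isUnit_algebraMap I p _ hp
  set M := A.submatrix id J with hM
  let w : Fin a → S K := M.adjugate.mulVec fun i => A i j
  -- By Cramer's rule this vector is in the kernel of `A`. It encodes the relation `det(A_J) x_j = ∑
  -- w_c x_{J c}` on `C`.
  have hmem : M.det • Pi.single j (1 : S K) - ∑ c, w c • Pi.single (J c) (1 : S K) ∈
      linearPart I := by
    apply hA
    have h1 : A.mulVec (∑ c, w c • Pi.single (J c) (1 : S K)) = M.mulVec w := by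
      ext1 i
      rw [← Matrix.mulVecLin_apply, map_sum, Finset.sum_apply]
      simp only [Matrix.mulVec, dotProduct]
      refine Finset.sum_congr rfl fun c _ => ?_
      rw [map_smul, Matrix.mulVecLin_apply, Matrix.mulVec_single_one, Pi.smul_apply, smul_eq_mul,
        mul_comm]
      rfl
    rw [Matrix.mulVec_sub, h1, Matrix.mulVec_smul, Matrix.mulVec_single_one, Matrix.mulVec_mulVec,
      Matrix.mul_adjugate, Matrix.smul_mulVec, Matrix.one_mulVec, sub_eq_zero]
    rfl
  have hx : ∀ l, xdot K n (Pi.single l 1) = x K l := fun l => by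
    simp [xdot_apply, Pi.single_apply, apply_ite]
  rw [mem_linearPart, map_sub, map_sum, xdot_smul, hx] at hmem
  simp only [xdot_smul, hx] at hmem
  have h2 := algebraMap_germ_of_mem p hmem
  rw [map_sub, map_sum, sub_eq_zero, map_mul, algebraMap_incl] at h2
  apply hu.mul_right_cancel
  rw [Finset.sum_mul, mul_comm (algebraMap (R K n) (Germ I p) (x K j)), h2]
  have h3 : ∀ i, zLocal I A J p i * algebraMap (S K) (Germ I p) (A i j) *
      algebraMap (S K) (Germ I p) M.det = ∑ c, algebraMap (R K n) (Germ I p) (x K (J c)) *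
        algebraMap (S K) (Germ I p) (M.adjugate c i * A i j) := fun i => by
    rw [mul_right_comm, zLocal_mul_det hp, Finset.sum_mul]
    refine Finset.sum_congr rfl fun c _ => ?_
    rw [map_mul, mul_assoc]
  simp only [h3]
  rw [Finset.sum_comm]
  refine Finset.sum_congr rfl fun c _ => ?_
  rw [← Finset.mul_sum, ← map_sum, map_mul, algebraMap_incl, mul_comm]
  rfl

/-- The equations with index in `J` already determine `z`, as `A_J` is invertible. With
`vecMul_zLocal` this yields agreement on overlaps. -/
theorem eq_zLocal {I : Ideal (R K n)} {A : Matrix (Fin a) (Fin (n - 1)) (S K)}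
    {J : Fin a ↪o Fin (n - 1)} {p : Pn K n} (hp : p ∈ U A J) {z : Fin a → Germ I p}
    (hz : ∀ j, ∑ i, z i * algebraMap (S K) (Germ I p) (A i j) =
      algebraMap (R K n) (Germ I p) (x K j)) : z = zLocal I A J p := by
  have h1 : (fun c => algebraMap (R K n) (Germ I p) (x K (J c))) =
      Matrix.vecMul z ((A.submatrix id J).map (algebraMap (S K) (Germ I p))) := by
    ext1 c
    rw [← hz]
    rfl
  rw [zLocal, h1, Matrix.vecMul_vecMul, Matrix.mul_nonsing_inv _ (isUnit_det_map hp),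
    Matrix.vecMul_one]

open Classical in
/-- The germs `z_i^J`, for any `J` with `p ∈ U_J`. -/
def zGerm (I : Ideal (R K n)) (A : Matrix (Fin a) (Fin (n - 1)) (S K)) (i : Fin a) (p : Pn K n) :
    Germ I p :=
  -- The default value is harmless: when the `U_J` cover `C`, the germ ring is zero at all other
  -- points.
  if h : ∃ J, p ∈ U A J then zLocal I A h.choose p i else 0

theorem zGerm_eq {I : Ideal (R K n)} {A : Matrix (Fin a) (Fin (n - 1)) (S K)}
    (hA : ∀ v, A.mulVec v = 0 → v ∈ linearPart I) {J : Fin a ↪o Fin (n - 1)} {p : Pn K n}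
    (hp : p ∈ U A J) (i : Fin a) : zGerm I A i p = zLocal I A J p i := by
  have h : ∃ J, p ∈ U A J := ⟨J, hp⟩
  rw [zGerm, dif_pos h]
  exact congrFun (eq_zLocal hp (vecMul_zLocal hA h.choose_spec)) i

theorem isOpen_basic (f : R K n) : IsOpen {p : Pn K n | f ∉ pt p} :=
  ProjectiveSpectrum.isOpen_basicOpen (homogeneousSubmodule (Fin (n - 1) ⊕ Fin 2) K) (a := f)

theorem isSection_zGerm {I : Ideal (R K n)} {A : Matrix (Fin a) (Fin (n - 1)) (S K)}
    (hA : ∀ v, A.mulVec v = 0 → v ∈ linearPart I) {α : Fin a → ℕ}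
    (hα : ∀ i j, (A i j).IsHomogeneous (α i))
    (hcov : ∀ p : Pn K n, I ≤ pt p → ∃ J, p ∈ U A J) (i : Fin a) :
    IsSection I (1 - (α i : ℤ)) (zGerm I A i) := by
  intro p
  by_cases hp : I ≤ pt p
  · obtain ⟨J, hJ⟩ := hcov p hp
    refine ⟨U A J, isOpen_basic _, hJ, 1 + ∑ i', Function.update α i 0 i', ∑ i', α i',
      ∑ c, x K (J c) * incl K n ((A.submatrix id J).adjugate c i),
      incl K n (A.submatrix id J).det, ?_, ?_, ?_, fun q hq => ⟨hq, ?_⟩⟩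
    · refine IsHomogeneous.sum _ _ _ fun c _ => (isHomogeneous_X K _).mul (incl_isHomogeneous ?_)
      exact adjugate_isHomogeneous (fun i j => hα i (J j)) c i
    · exact incl_isHomogeneous (det_isHomogeneous fun i j => hα i (J j))
    · have h1 : ∑ i', α i' = α i + ∑ i', Function.update α i 0 i' := by
        rw [Finset.sum_update_of_mem (Finset.mem_univ i), zero_add,
          Finset.sdiff_singleton_eq_erase, Finset.add_sum_erase _ _ (Finset.mem_univ i)]
      rw [h1]
      push_cast
      ring
    · refine (eq_frac_iff I q _ _ hq _).2 ?_
      rw [zGerm_eq hA hq, algebraMap_incl, zLocal_mul_det hq, map_sum]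
      refine Finset.sum_congr rfl fun c _ => ?_
      rw [map_mul, algebraMap_incl]
  · obtain ⟨f, hf, hfp⟩ := Set.not_subset.1 hp
    -- Away from `C` any fraction of the right degree will do; the zero section supplies one.
    obtain ⟨V, hV, hpV, i', j', g, h, hg, hh, hd, hs⟩ := (0 : H0 I (1 - (α i : ℤ))).2 p
    refine ⟨V ∩ {q | f ∉ pt q}, hV.inter (isOpen_basic f), ⟨hpV, hfp⟩, i', j', g, h, hg, hh, hd,
      fun q hq => ⟨(hs q hq.1).1, ?_⟩⟩
    have := subsingleton_germ hf hq.2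
    exact Subsingleton.elim _ _

theorem existsUnique_isGlued {I : Ideal (R K n)} {A : Matrix (Fin a) (Fin (n - 1)) (S K)}
    (hA : ∀ v, A.mulVec v = 0 → v ∈ linearPart I) {α : Fin a → ℕ}
    (hα : ∀ i j, (A i j).IsHomogeneous (α i))
    (hcov : ∀ p : Pn K n, I ≤ pt p → ∃ J, p ∈ U A J) :
    ∃! z : ∀ i : Fin a, H0 I (1 - (α i : ℤ)), IsGlued I α A z := by
  refine ⟨fun i => ⟨zGerm I A i, isSection_zGerm hA hα hcov i⟩,
    fun J p hp i => zGerm_eq hA hp i, fun z hz => ?_⟩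
  ext1 i
  apply Subtype.ext
  ext1 p
  change (z i).1 p = zGerm I A i p
  by_cases hp : I ≤ pt p
  · obtain ⟨J, hJ⟩ := hcov p hp
    rw [hz J p hJ i, zGerm_eq hA hJ]
  · obtain ⟨f, hf, hfp⟩ := Set.not_subset.1 hp
    have := subsingleton_germ hf hfp
    exact Subsingleton.elim _ _

theorem algebraMap_genericRing (f : S K) :
    algebraMap (S K) (GenericRing F a) f = TrivSqZeroExt.inl (algebraMap (S K) F f) := by
  rw [TrivSqZeroExt.algebraMap_eq_inl']

theorem smul_one_add_sum_smul_inr (P : S K) (Q : Fin a → S K) :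
    P • (1 : GenericRing F a) + ∑ i, Q i • TrivSqZeroExt.inr (Pi.single i (1 : F)) =
      TrivSqZeroExt.inl (algebraMap _ _ P) + TrivSqZeroExt.inr fun i => algebraMap _ _ (Q i) := by
  have h1 : (fun i => algebraMap (S K) F (Q i)) = ∑ i, Q i • Pi.single i (1 : F) := by
    ext1 l
    rw [Finset.sum_apply, Finset.sum_eq_single l]
    · rw [Pi.smul_apply, Pi.single_eq_same, Algebra.smul_def, mul_one]
    · intro i _ hi
      rw [Pi.smul_apply, Pi.single_eq_of_ne hi.symm, smul_zero]
    · simp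
  rw [Algebra.smul_def, mul_one, algebraMap_genericRing, h1]
  congr 1
  rw [← TrivSqZeroExt.inrHom_apply F, map_sum]
  refine Finset.sum_congr rfl fun i _ => ?_
  rw [TrivSqZeroExt.inrHom_apply, TrivSqZeroExt.inr_smul]

/-- The expansion of `z_i` at the generic point is the `i`-th coordinate vector. -/
theorem germExpansion_z [IsFractionRing (S K) F] {I : Ideal (R K n)}
    {A : Matrix (Fin a) (Fin (n - 1)) (S K)} (hI : ∀ f ∈ I, genericExpansion F A f = 0)
    {J : Fin a ↪o Fin (n - 1)} (hJ : (A.submatrix id J).det ≠ 0)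
    {z : Fin a → Germ I (genericPoint K n)}
    (hz : ∀ j, ∑ i, z i * algebraMap (S K) (Germ I (genericPoint K n)) (A i j) =
      algebraMap (R K n) (Germ I (genericPoint K n)) (x K j)) (i : Fin a) :
    germExpansion F A hI (z i) = TrivSqZeroExt.inr (Pi.single i (1 : F)) := by
  -- The expanded `z_i` and the coordinate vectors solve the same system `x = z A`, and `A_J` is
  -- invertible over `GenericRing F a`.
  have h1 : ∀ j, ∑ i, germExpansion F A hI (z i) * algebraMap (S K) (GenericRing F a) (A i j) =
      ∑ i, TrivSqZeroExt.inr (Pi.single i (1 : F)) * algebraMap (S K) (GenericRing F a) (A i j) := by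
    intro j
    have h2 := congrArg (germExpansion F A hI) (hz j)
    rw [map_sum, germExpansion_algebraMap] at h2
    have h3 : ∑ i, TrivSqZeroExt.inr (Pi.single i (1 : F)) *
        algebraMap (S K) (GenericRing F a) (A i j) = genericExpansion F A (x K j) := by
      have h4 := smul_one_add_sum_smul_inr F 0 (fun i => A i j)
      rw [zero_smul, zero_add, map_zero, TrivSqZeroExt.inl_zero, zero_add] at h4
      refine Eq.trans (Finset.sum_congr rfl fun i _ => ?_) (h4.trans ?_)
      · rw [Algebra.smul_def, mul_comm]
      · refine TrivSqZeroExt.ext ?_ (funext fun i => ?_)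
        · rw [fst_genericExpansion, restr_x, map_zero, TrivSqZeroExt.fst_inr]
        · rw [snd_genericExpansion, TrivSqZeroExt.snd_inr, linVec_apply]
          congr 1
          simp [Matrix.mulVec, dotProduct]
    rw [h3, ← h2]
    refine Finset.sum_congr rfl fun i _ => ?_
    rw [map_mul, ← algebraMap_incl, germExpansion_algebraMap, genericExpansion_incl]
  have hu : IsUnit ((A.submatrix id J).map (algebraMap (S K) (GenericRing F a))).det := by
    rw [← RingHom.mapMatrix_apply, ← RingHom.map_det, ← genericExpansion_incl F A]
    exact isUnit_genericExpansion F A (by rwa [restr_incl])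
  have h5 : Matrix.vecMul (fun i => germExpansion F A hI (z i))
      ((A.submatrix id J).map (algebraMap (S K) (GenericRing F a))) =
      Matrix.vecMul (fun i => TrivSqZeroExt.inr (Pi.single i (1 : F)))
      ((A.submatrix id J).map (algebraMap (S K) (GenericRing F a))) := funext fun c => h1 (J c)
  have h6 := congrArg (fun v => Matrix.vecMul v
    ((A.submatrix id J).map (algebraMap (S K) (GenericRing F a)))⁻¹) h5
  simp only [Matrix.vecMul_vecMul, Matrix.mul_nonsing_inv _ hu, Matrix.vecMul_one] at h6
  exact congrFun h6 i

/-! ### The module of sections -/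

theorem smul_mem_H0 {I : Ideal (R K n)} {e d d' : ℤ} {f : S K} (hf : f ∈ SDeg K e)
    {s : ∀ p : Pn K n, Germ I p} (hs : s ∈ H0 I d') (hd : e + d' = d) : f • s ∈ H0 I d := by
  rcases hf with rfl | ⟨m, rfl, hf⟩
  · rw [zero_smul]
    exact (H0 I d).zero_mem
  · rw [← hd]
    exact IsSection.smul hs hf

/-- Identifies the graded module structure on `H0star I` with the pointwise action on germs. -/
theorem of_smul_eq {I : Ideal (R K n)} {e d d' : ℤ} {f : S K} (hf : f ∈ SDeg K e)
    (s : H0 I d') (hd : e + d' = d) :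
    DirectSum.of (fun d => H0 I d) d ⟨f • s.1, smul_mem_H0 hf s.2 hd⟩ =
      f • (DirectSum.of (fun d => H0 I d) d' s : H0star I) := by
  rcases hf with rfl | ⟨m, rfl, hf⟩
  · have h0 : (⟨(0 : S K) • s.1, smul_mem_H0 (zero_mem_SDeg e) s.2 hd⟩ : H0 I d) = 0 :=
      Subtype.ext (zero_smul _ _)
    exact (congrArg (DirectSum.of (fun d => H0 I d) d) h0).trans
      ((map_zero _).trans (zero_smul (S K) _).symm)
  · subst hd
    have h1 : f • (DirectSum.of (fun d => H0 I d) d' s : H0star I) =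
        DirectSum.Gmodule.smulAddMonoidHom
          (fun i => homogeneousSubmodule (Fin 2) K i) (fun d => H0 I d)
          (DirectSum.decompose (homogeneousSubmodule (Fin 2) K) f)
          (DirectSum.of (fun d => H0 I d) d' s) := rfl
    rw [h1, DirectSum.decompose_of_mem (homogeneousSubmodule (Fin 2) K) (i := m) hf]
    refine Eq.trans ?_ (DirectSum.Gmodule.smulAddMonoidHom_apply_of_of
      (fun i => homogeneousSubmodule (Fin 2) K i) (fun d => H0 I d) _ _).symm
    exact DirectSum.of_eq_of_gradedMonoid_eq (Sigma.subtype_ext rfl rfl)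

/-- The expansion at the generic point of the elements of `H⁰_*`. -/
def starExpansion [IsFractionRing (S K) F] {I : Ideal (R K n)}
    (A : Matrix (Fin a) (Fin (n - 1)) (S K)) (hI : ∀ f ∈ I, genericExpansion F A f = 0) :
    H0star I →+ GenericRing F a :=
  DirectSum.toAddMonoid fun d =>
    { toFun := fun s : H0 I d => germExpansion F A hI (s.1 (genericPoint K n))
      map_zero' := map_zero _
      map_add' := fun _ _ => map_add (germExpansion F A hI) _ _ }

theorem starExpansion_of [IsFractionRing (S K) F] {I : Ideal (R K n)}
    (A : Matrix (Fin a) (Fin (n - 1)) (S K)) (hI : ∀ f ∈ I, genericExpansion F A f = 0)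
    {d : ℤ} (s : H0 I d) : starExpansion F A hI (DirectSum.of (fun d => H0 I d) d s) =
      germExpansion F A hI (s.1 (genericPoint K n)) :=
  DirectSum.toAddMonoid_of _ _ _

theorem starExpansion_smul [IsFractionRing (S K) F] {I : Ideal (R K n)}
    (A : Matrix (Fin a) (Fin (n - 1)) (S K)) (hI : ∀ f ∈ I, genericExpansion F A f = 0)
    (f : S K) (s : H0star I) :
    starExpansion F A hI (f • s) = f • starExpansion F A hI s := by
  induction s using DirectSum.induction_on with
  | zero => rw [smul_zero, map_zero, smul_zero]
  | add _ _ hs ht => rw [smul_add, map_add, map_add, hs, ht, smul_add]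
  | of d s =>
    rw [← sum_homogeneousComponent (φ := f), Finset.sum_smul, Finset.sum_smul, map_sum]
    refine Finset.sum_congr rfl fun m _ => ?_
    rw [← of_smul_eq (SDeg_of_isHomogeneous (homogeneousComponent_isHomogeneous m f)) s rfl,
      starExpansion_of, starExpansion_of]
    exact germExpansion_smul F A hI _ _

theorem linearIndependent_generators [IsFractionRing (S K) F] :
    LinearIndependent (S K) (fun o : Option (Fin a) =>
      o.elim (1 : GenericRing F a) fun i => TrivSqZeroExt.inr (Pi.single i (1 : F))) := by
  have hinj := IsFractionRing.injective (S K) F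
  rw [Fintype.linearIndependent_iff]
  intro g hg
  rw [Fintype.sum_option] at hg
  have h1 := (smul_one_add_sum_smul_inr F (g none) (fun i => g (some i))).symm.trans hg
  rintro (_ | i)
  · have h2 := congrArg TrivSqZeroExt.fst h1
    rw [TrivSqZeroExt.fst_add, TrivSqZeroExt.fst_inl, TrivSqZeroExt.fst_inr, add_zero,
      TrivSqZeroExt.fst_zero] at h2
    exact (map_eq_zero_iff _ hinj).1 h2
  · have h2 := congrFun (congrArg TrivSqZeroExt.snd h1) i
    rw [TrivSqZeroExt.snd_add, TrivSqZeroExt.snd_inl, TrivSqZeroExt.snd_inr, zero_add,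
      TrivSqZeroExt.snd_zero] at h2
    exact (map_eq_zero_iff _ hinj).1 h2

theorem combination_mem_H0 {I : Ideal (R K n)} {α : Fin a → ℕ}
    (z : ∀ i : Fin a, H0 I (1 - (α i : ℤ))) {d : ℤ} {P : S K} {Q : Fin a → S K}
    (hP : P ∈ SDeg K d) (hQ : ∀ i, Q i ∈ SDeg K (d + α i - 1)) :
    P • (one I).1 + ∑ i, Q i • (z i).1 ∈ H0 I d :=
  (H0 I d).add_mem (smul_mem_H0 hP (one I).2 (add_zero d))
    ((H0 I d).sum_mem fun i _ => smul_mem_H0 (hQ i) (z i).2 (by ring))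

/-- The combination formed from the coefficients of the expansion of `s` has the same expansion as
`s`, so `section_eq_zero` applies to the difference. -/
theorem H0_eq [IsFractionRing (S K) F] {I : Ideal (R K n)}
    {A : Matrix (Fin a) (Fin (n - 1)) (S K)}
    (hA : ∀ f, genericExpansion F A f = 0 ↔ f ∈ I)
    (hsupp : ∀ p : Pn K n, I ≤ pt p → lineIdeal K n ≤ pt p) {α : Fin a → ℕ}
    (hα : ∀ i j, (A i j).IsHomogeneous (α i)) {z : ∀ i : Fin a, H0 I (1 - (α i : ℤ))}
    (hz : ∀ i, germExpansion F A (fun f hf => (hA f).2 hf) ((z i).1 (genericPoint K n)) =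
      TrivSqZeroExt.inr (Pi.single i (1 : F))) (d : ℤ) :
    (H0 I d : Set (∀ p : Pn K n, Germ I p)) =
      {s | ∃ (P : S K) (Q : Fin a → S K), P ∈ SDeg K d ∧ (∀ i, Q i ∈ SDeg K (d + α i - 1)) ∧
        s = P • (one I).1 + ∑ i, Q i • (z i).1} := by
  ext s
  constructor
  · intro hs
    obtain ⟨P, Q, hP, hQ, e⟩ := exists_coefficients F hA hα hs
    refine ⟨P, Q, hP, hQ, ?_⟩
    rw [← sub_eq_zero]
    refine section_eq_zero F hA hsupp ((H0 I d).sub_mem hs (combination_mem_H0 z hP hQ)) ?_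
    rw [Pi.sub_apply, map_sub, e, Pi.add_apply, Finset.sum_apply, map_add, map_sum, sub_eq_zero,
      ← smul_one_add_sum_smul_inr]
    congr 1
    · rw [Pi.smul_apply, germExpansion_smul]
      congr 1
      exact (map_one (germExpansion F A _)).symm
    · refine Finset.sum_congr rfl fun i _ => ?_
      rw [Pi.smul_apply, germExpansion_smul, hz]
  · rintro ⟨P, Q, hP, hQ, rfl⟩
    exact combination_mem_H0 z hP hQ

/-- Independence is tested after the `S`-linear expansion into `GenericRing F a`; generation is
`hH`, degree by degree. -/
theorem exists_basis_H0star [IsFractionRing (S K) F] {I : Ideal (R K n)}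
    {A : Matrix (Fin a) (Fin (n - 1)) (S K)} (hI : ∀ f ∈ I, genericExpansion F A f = 0)
    {α : Fin a → ℕ} {z : ∀ i : Fin a, H0 I (1 - (α i : ℤ))}
    (hz : ∀ i, germExpansion F A hI ((z i).1 (genericPoint K n)) =
      TrivSqZeroExt.inr (Pi.single i (1 : F)))
    (hH : ∀ d : ℤ, (H0 I d : Set (∀ p : Pn K n, Germ I p)) =
      {s | ∃ (P : S K) (Q : Fin a → S K), P ∈ SDeg K d ∧ (∀ i, Q i ∈ SDeg K (d + α i - 1)) ∧
        s = P • (one I).1 + ∑ i, Q i • (z i).1}) :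
    ∃ b : Module.Basis (Option (Fin a)) (S K) (H0star I),
      b none = DirectSum.of (fun d => H0 I d) 0 (one I) ∧
      ∀ i, b (some i) = DirectSum.of (fun d => H0 I d) (1 - (α i : ℤ)) (z i) := by
  let w : Option (Fin a) → H0star I := fun o =>
    o.elim (DirectSum.of (fun d => H0 I d) 0 (one I))
      fun i => DirectSum.of (fun d => H0 I d) (1 - (α i : ℤ)) (z i)
  let Λ : H0star I →ₗ[S K] GenericRing F a :=
    { toFun := starExpansion F A hI
      map_add' := map_add _
      map_smul' := fun f s => starExpansion_smul F A hI f s }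
  have hli : LinearIndependent (S K) w := by
    apply LinearIndependent.of_comp Λ
    have : Λ ∘ w = fun o : Option (Fin a) =>
        o.elim (1 : GenericRing F a) fun i => TrivSqZeroExt.inr (Pi.single i (1 : F)) := by
      funext o
      rcases o with _ | i
      · exact (starExpansion_of F A hI _).trans (map_one (germExpansion F A hI))
      · exact (starExpansion_of F A hI _).trans (hz i)
    rw [this]
    exact linearIndependent_generators F
  have hsp : ⊤ ≤ Submodule.span (S K) (Set.range w) := by
    intro s _
    induction s using DirectSum.induction_on with
    | zero => exact Submodule.zero_mem _
    | add _ _ hs ht => exact Submodule.add_mem _ (hs trivial) (ht trivial)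
    | of d s =>
      have hs : s.1 ∈ (H0 I d : Set (∀ p : Pn K n, Germ I p)) := s.2
      rw [hH] at hs
      obtain ⟨P, Q, hP, hQ, e⟩ := hs
      have h1 : s = ⟨P • (one I).1, smul_mem_H0 hP (one I).2 (add_zero d)⟩ +
          ∑ i, ⟨Q i • (z i).1, smul_mem_H0 (hQ i) (z i).2 (by ring)⟩ := by
        apply Subtype.ext
        rw [Submodule.coe_add, Submodule.coe_sum, e]
      rw [h1, map_add, map_sum, of_smul_eq hP (one I) (add_zero d)]
      refine Submodule.add_mem _ (Submodule.smul_mem _ _ (Submodule.subset_span ⟨none, rfl⟩))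
        (Submodule.sum_mem _ fun i _ => ?_)
      rw [of_smul_eq (hQ i) (z i) (by ring)]
      exact Submodule.smul_mem _ _ (Submodule.subset_span ⟨some i, rfl⟩)
  exact ⟨Module.Basis.mk hli hsp, Module.Basis.mk_apply hli hsp none,
    fun i => Module.Basis.mk_apply hli hsp (some i)⟩

/-- Surjectivity on the stalk gives a right inverse over the local ring, so some maximal minor lies
outside its maximal ideal. Hence the `U_J` cover `L`. -/
theorem IsAssociated.exists_minor {k : ℕ} {I : Ideal (R K n)} {α : Fin (n - 1 - k) → ℕ}
    {β : Fin k → ℕ} {A : Matrix (Fin (n - 1 - k)) (Fin (n - 1)) (S K)}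
    {B : Matrix (Fin (n - 1)) (Fin k) (S K)} (h : IsAssociated I α β A B)
    (q : ProjectiveSpectrum (homogeneousSubmodule (Fin 2) K)) :
    ∃ J : Fin (n - 1 - k) ↪o Fin (n - 1), (A.submatrix id J).det ∉ lpt q := by
  obtain ⟨C, hC⟩ := Matrix.mulVec_surjective_iff_exists_right_inverse.1 (h.surjective q)
  obtain ⟨J, hJ⟩ := exists_minor_notMem hC
    (IsLocalRing.maximalIdeal.isMaximal (Localization.AtPrime (lpt q))).ne_top
  refine ⟨J, fun hd => hJ ?_⟩
  rw [Matrix.submatrix_map, ← RingHom.mapMatrix_apply, ← RingHom.map_det]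
  exact (IsLocalization.AtPrime.to_map_mem_maximal_iff (Localization.AtPrime (lpt q)) (lpt q) _).2 hd

end Rope

end

/-! ### The theorem -/

theorem mainTheorem5 {K : Type*} [Field K] (n k : ℕ) (hn : 2 ≤ n) (hk : k < n)
    (I : Ideal (Rope.R K n)) (hI : Rope.IsRope I (n - k)) :
    (∃ (α : Fin (n - 1 - k) → ℕ) (β : Fin k → ℕ)
      (A : Matrix (Fin (n - 1 - k)) (Fin (n - 1)) (Rope.S K))
      (B : Matrix (Fin (n - 1)) (Fin k) (Rope.S K)), Rope.IsAssociated I α β A B) ∧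
    ∀ (α : Fin (n - 1 - k) → ℕ) (β : Fin k → ℕ)
      (A : Matrix (Fin (n - 1 - k)) (Fin (n - 1)) (Rope.S K))
      (B : Matrix (Fin (n - 1)) (Fin k) (Rope.S K)), Rope.IsAssociated I α β A B →
      (∃! z : ∀ i : Fin (n - 1 - k), Rope.H0 I (1 - (α i : ℤ)), Rope.IsGlued I α A z) ∧
      ∀ z : ∀ i : Fin (n - 1 - k), Rope.H0 I (1 - (α i : ℤ)), Rope.IsGlued I α A z →
        (∀ d : ℤ, (Rope.H0 I d : Set (∀ p : Rope.Pn K n, Rope.Germ I p)) =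
          {s | ∃ (P : Rope.S K) (Q : Fin (n - 1 - k) → Rope.S K),
            P ∈ Rope.SDeg K d ∧ (∀ i, Q i ∈ Rope.SDeg K (d + α i - 1)) ∧
            s = P • (Rope.one I).1 + ∑ i, Q i • (z i).1}) ∧
        ∃ b : Module.Basis (Option (Fin (n - 1 - k))) (Rope.S K) (Rope.H0star I),
          b none = DirectSum.of (fun d => Rope.H0 I d) 0 (Rope.one I) ∧
          ∀ i, b (some i) = DirectSum.of (fun d => Rope.H0 I d) (1 - (α i : ℤ)) (z i) := by
  refine ⟨?_, fun α β A B h => ?_⟩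
  · obtain ⟨α, β, A, B, h, -⟩ := hI.exists_isAssociated hn hk
    exact ⟨α, β, A, B, h⟩
  have hA := h.mulVec_eq_zero_iff hn hk hI
  have hcov : ∀ p : Rope.Pn K n, I ≤ Rope.pt p → ∃ J, p ∈ Rope.U A J := fun p hp => by
    obtain ⟨q, rfl⟩ := Rope.exists_eq_linePoint ((hI.support p).1 hp)
    obtain ⟨J, hJ⟩ := h.exists_minor q
    exact ⟨J, Rope.mem_U_linePoint.2 hJ⟩
  refine ⟨Rope.existsUnique_isGlued (fun v => (hA v).1) h.homA hcov, fun z hz => ?_⟩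
  have hgen : ∀ f, Rope.genericExpansion (FractionRing (Rope.S K)) A f = 0 ↔ f ∈ I := fun f =>
    Rope.genericExpansion_eq_zero_iff _ hI.sq_le hI.le_lineIdeal hA
  obtain ⟨J, hJ⟩ := h.exists_minor (Rope.genericLine K)
  have hη : Rope.genericPoint K n ∈ Rope.U A J := Rope.mem_U_linePoint.2 hJ
  have hz' := Rope.germExpansion_z (FractionRing (Rope.S K)) (fun f hf => (hgen f).2 hf)
    (fun h0 => hJ (by rw [h0]; exact Ideal.zero_mem _))
    (z := fun i => (z i).1 (Rope.genericPoint K n)) (fun j => by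
      simp only [hz J _ hη]
      exact Rope.vecMul_zLocal (fun v => (hA v).1) hη j)
  have hH := Rope.H0_eq _ hgen (fun p => (hI.support p).1) h.homA hz'
  exact ⟨hH, Rope.exists_basis_H0star _ (fun f hf => (hgen f).2 hf) hz' hH⟩
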